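/- Consider a system of $N$ second order ordinary differential equations $\ddot y=\omega(x,y,\dot y)$, $y=(y^1,\dots,y^N)$, with $\omega$ smooth on an open set $U$ of the space of the variables $(x,y,\dot y)$ lying over an open set $\Omega$ of the space of the variables $(x,y)$, and let $\mathbf A=\partial_x+\dot y^\kappa\partial_{y^\kappa}+\omega^\kappa\partial_{\dot y^\kappa}$. For a vector field $\mathbf Z=\xi\,\partial_x+\eta^\mu\partial_{y^\mu}$ on $\Omega$ let $\mathbf Z^{(1)}=\xi\,\partial_x+\eta^\mu\partial_{y^\mu}+\bigl(\tfrac{d\eta^\mu}{dx}-\dot y^\mu\tfrac{d\xi}{dx}\bigr)\partial_{\dot y^\mu}$, with $\tfrac{d}{dx}=\partial_x+\dot y^\kappa\partial_{y^\kappa}$, be its first prolongation; $\mathbf Z$ is a Lie point symmetry of the system if $[\mathbf Z^{(1)},\mathbf A]=-\mathbf A(\xi)\,\mathbf A$ on $U$. Let $\mathbf g^{(0)}$ be a finite-dimensional real Lie algebra of smooth vector fields on $\Omega$, all of which are Lie point symmetries of the system. Let $\mathbf g^{(i+1)}=[\mathbf g^{(i)},\mathbf g^{(i)}]$, and assume that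 $\mathbf g^{(0)}$ is $n$-level solvable, $n\ge 1$, i.e. $\mathbf g^{(n)}=\{0\}$ and $\mathbf g^{(k)}\neq\{0\}$ for $k<n$. Assume also that $\mathbf g^{(n-1)}$ acts transitively in a subspace of dimension $m=\dim\mathbf g^{(n-1)}$, i.e. that a nonzero element of $\mathbf g^{(n-1)}$ vanishes at no point of $\Omega$. Then the invariant subalgebra $\mathbf g^{(n-1)}$ is Abelian, and for every basis $\mathbf Z_1,\dots,\mathbf Z_m$ of it the following hold. (a) The generators can be brought to normal form. If $(x,y)\in\Omega$ and $(1,\dot y)$ is not in the span of the vectors $\mathbf Z_i(x,y)$, then there are smooth coordinates $(t,s^i,s^\beta)$, $1\le i\le m<\beta\le N$, on a neighbourhood of $(x,y)$ in which $\mathbf Z_i=\partial_{s^i}$ for all $i$, with $\tfrac{dt}{dx}\neq0$ at $(x,y,\dot y)$. (b) The remaining generators are inherited. Let $(t,s^i,s^\beta)$ be any smooth coordinates on an open subset of $\Omega$ in which $\mathbf Z_i=\partial_{s^i}$ for all $i$, and put $\dot s=\tfrac{ds}{dx}\big/\tfrac{dt}{dx}$. Every point of $U$ lying over this subset at which $\tfrac{dt}{dx}\ne0$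 has an open neighbourhood $O\subseteq U$ such that the set $W$ of the values on $O$ of the reduced variables $(t,s^\beta,u^i=\dot s^i,\dot s^\beta)$ is open and the system on $O$ reads $$\dot u^i=\hat\omega^i(t,s^\alpha,u^j,\dot s^\alpha),\qquad \ddot s^\beta=\hat\omega^\beta(t,s^\alpha,u^j,\dot s^\alpha)$$ with $\hat\omega$ smooth on $W$. Let $\hat{\mathbf A}=\partial_t+\dot s^\beta\partial_{s^\beta}+\hat\omega^i\partial_{u^i}+\hat\omega^\beta\partial_{\dot s^\beta}$. For every $\mathbf Z$ in the "coset" $\mathbf B^{(0)}_{(n-1)}=\mathbf g^{(0)}-\mathbf g^{(n-1)}$ the prolonged and reduced generator $$\mathbf Y=\mathbf Z^{(1)}(t)\,\partial_t+\mathbf Z^{(1)}(s^\beta)\,\partial_{s^\beta}+\mathbf Z^{(1)}(u^i)\,\partial_{u^i}+\mathbf Z^{(1)}(\dot s^\beta)\,\partial_{\dot s^\beta}$$ is a well-defined smooth vector field on $W$, its components along $\partial_t$ and $\partial_{s^\beta}$ are functions of $(t,s^\alpha)$ only, and it is a symmetry of the reduced equations: $[\mathbf Y,\hat{\mathbf A}]=-\hat{\mathbf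 A}(\hat\xi)\,\hat{\mathbf A}$ on $W$, where $\hat\xi=\mathbf Z^{(1)}(t)$ is the component of $\mathbf Y$ along $\partial_t$. -/

import Mathlib

open scoped ContDiff

/-! ### The Lie algebra of smooth vector fields on an open set -/

section VectorFields

variable {E : Type*} [NormedAddCommGroup E] [NormedSpace ℝ E]

/-- The smooth vector fields on the open set `Ω`. A field on `Ω` is represented by its unique
extension by zero to the whole space, so that two fields are equal iff they agree on `Ω`. -/
def smoothVectorFields (Ω : TopologicalSpace.Opens E) : Submodule ℝ (E → E) where
  carrier := {X | ContDiffOn ℝ ∞ X Ω ∧ ∀ p ∉ Ω, X p = 0}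
  add_mem' := fun hX hY => ⟨hX.1.add hY.1, fun p hp => by simp [hX.2 p hp, hY.2 p hp]⟩
  zero_mem' := ⟨contDiffOn_const, fun _ _ => rfl⟩
  smul_mem' := fun c X hX => ⟨hX.1.const_smul c, fun p hp => by simp [hX.2 p hp]⟩

namespace smoothVectorFields

variable {Ω : TopologicalSpace.Opens E}

lemma contDiffAt (X : smoothVectorFields Ω) {p : E} (hp : p ∈ Ω) : ContDiffAt ℝ ∞ X.1 p :=
  X.2.1.contDiffAt (Ω.isOpen.mem_nhds hp)

lemma differentiableAt (X : smoothVectorFields Ω) {p : E} (hp : p ∈ Ω) :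
    DifferentiableAt ℝ X.1 p :=
  (contDiffAt X hp).differentiableAt (by simp)

open Classical in
/-- The commutator of two vector fields on `Ω`, `[X, Y] = X(Y) - Y(X)`. -/
noncomputable instance : Bracket (smoothVectorFields Ω) (smoothVectorFields Ω) where
  bracket X Y := ⟨fun p => if p ∈ Ω then VectorField.lieBracket ℝ X.1 Y.1 p else 0, by
    refine ⟨?_, fun p hp => if_neg hp⟩
    have h : ContDiffOn ℝ ∞ (VectorField.lieBracket ℝ X.1 Y.1) Ω := fun p hp =>
      ((contDiffAt X hp).lieBracket_vectorField (m := ∞) (contDiffAt Y hp)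
        (by simp)).contDiffWithinAt
    exact h.congr fun p hp => if_pos hp⟩

lemma bracket_apply (X Y : smoothVectorFields Ω) {p : E} (hp : p ∈ Ω) :
    ⁅X, Y⁆.1 p = VectorField.lieBracket ℝ X.1 Y.1 p :=
  if_pos hp

lemma bracket_eventuallyEq (X Y : smoothVectorFields Ω) {p : E} (hp : p ∈ Ω) :
    ⁅X, Y⁆.1 =ᶠ[nhds p] VectorField.lieBracket ℝ X.1 Y.1 :=
  Filter.eventually_of_mem (Ω.isOpen.mem_nhds hp) fun _ hq => bracket_apply X Y hq

lemma ext_on {X Y : smoothVectorFields Ω} (h : ∀ p ∈ Ω, X.1 p = Y.1 p) : X = Y := by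
  apply Subtype.ext
  funext p
  by_cases hp : p ∈ Ω
  · exact h p hp
  · rw [X.2.2 p hp, Y.2.2 p hp]

noncomputable instance : LieRing (smoothVectorFields Ω) where
  add_lie X Y Z := ext_on fun p hp => by
    rw [bracket_apply _ _ hp]
    change _ = ⁅X, Z⁆.1 p + ⁅Y, Z⁆.1 p
    rw [bracket_apply _ _ hp, bracket_apply _ _ hp]
    exact VectorField.lieBracket_add_left (differentiableAt X hp) (differentiableAt Y hp)
  lie_add X Y Z := ext_on fun p hp => by
    rw [bracket_apply _ _ hp]
    change _ = ⁅X, Y⁆.1 p + ⁅X, Z⁆.1 p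
    rw [bracket_apply _ _ hp, bracket_apply _ _ hp]
    exact VectorField.lieBracket_add_right (differentiableAt Y hp) (differentiableAt Z hp)
  lie_self X := ext_on fun p hp => by
    rw [bracket_apply _ _ hp, VectorField.lieBracket_self]
    rfl
  leibniz_lie X Y Z := ext_on fun p hp => by
    change _ = ⁅⁅X, Y⁆, Z⁆.1 p + ⁅Y, ⁅X, Z⁆⁆.1 p
    rw [bracket_apply _ _ hp, bracket_apply _ _ hp, bracket_apply _ _ hp,
      Filter.EventuallyEq.rfl.lieBracket_vectorField_eq (bracket_eventuallyEq Y Z hp),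
      (bracket_eventuallyEq X Y hp).lieBracket_vectorField_eq Filter.EventuallyEq.rfl,
      Filter.EventuallyEq.rfl.lieBracket_vectorField_eq (bracket_eventuallyEq X Z hp)]
    exact VectorField.leibniz_identity_lieBracket (n := ∞) (by simpa using (by exact_mod_cast le_top : ((2 : ℕ∞) : WithTop ℕ∞) ≤ ∞))
      (contDiffAt X hp) (contDiffAt Y hp) (contDiffAt Z hp)

noncomputable instance : LieAlgebra ℝ (smoothVectorFields Ω) where
  lie_smul c X Y := ext_on fun p hp => by
    change _ = c • ⁅X, Y⁆.1 p
    rw [bracket_apply _ _ hp, bracket_apply _ _ hp]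
    exact VectorField.lieBracket_const_smul_right (differentiableAt Y hp)

end smoothVectorFields

end VectorFields

/-! ### Solvable Lie algebras of a given level, and differences of derived algebras -/

/-- `L` is an `n`-level solvable Lie algebra: the derived algebras
`L = L⁽⁰⁾ ⊃ L⁽¹⁾ ⊃ ⋯ ⊃ L⁽ⁿ⁻¹⁾ ⊃ L⁽ⁿ⁾ = 0` reach zero at step `n` and not before. -/
def IsSolvableOfLevel (L : Type*) [LieRing L] [LieAlgebra ℝ L] (n : ℕ) : Prop :=
  LieAlgebra.derivedSeries ℝ L n = ⊥ ∧ ∀ k < n, LieAlgebra.derivedSeries ℝ L k ≠ ⊥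

/-- The "coset" `B⁽ⁱ⁾₍ⱼ₎ = L⁽ⁱ⁾ - L⁽ʲ⁾`: the elements of the `i`-th derived algebra which do not
belong to the `j`-th one. -/
def derivedCoset (L : Type*) [LieRing L] [LieAlgebra ℝ L] (i j : ℕ) : Set L :=
  {Z | Z ∈ LieAlgebra.derivedSeries ℝ L i ∧ Z ∉ LieAlgebra.derivedSeries ℝ L j}

/-! ### Second order systems and their point symmetries -/

/-- The space of the variables `(x, y)`: one independent variable `x` and dependent
variables `y ∈ V`. -/
abbrev BaseSpace (V : Type*) := ℝ × V

/-- The space of the variables `(x, y, ẏ)`. -/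
abbrev JetSpace (V : Type*) := ℝ × V × V

section Systems

variable {V : Type*} [NormedAddCommGroup V] [NormedSpace ℝ V]

/-- The point `(x, y)` below `(x, y, ẏ)`. -/
def JetSpace.base (j : JetSpace V) : BaseSpace V := (j.1, j.2.1)

/-- The total derivative `dh/dx = ∂h/∂x + ẏ ∂h/∂y` of a function `h(x, y)`, a function of
`(x, y, ẏ)`. -/
noncomputable def totalDeriv {F : Type*} [NormedAddCommGroup F] [NormedSpace ℝ F]
    (h : BaseSpace V → F) (j : JetSpace V) : F :=
  fderiv ℝ h j.base (1, j.2.2)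

/-- The operator `A = ∂_x + ẏ ∂_y + f(x, y, ẏ) ∂_ẏ` of the system `ÿ = f(x, y, ẏ)`. -/
def systemField (f : JetSpace V → V) (j : JetSpace V) : JetSpace V := (1, j.2.2, f j)

/-- The first prolongation `ξ ∂_x + η ∂_y + (dη/dx - ẏ dξ/dx) ∂_ẏ` of the field
`Z = ξ ∂_x + η ∂_y` on the space of the variables `(x, y)`. -/
noncomputable def prolongation (Z : BaseSpace V → BaseSpace V) (j : JetSpace V) : JetSpace V :=
  ((Z j.base).1, (Z j.base).2,
    totalDeriv (fun p => (Z p).2) j - totalDeriv (fun p => (Z p).1) j • j.2.2)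

/-- The vector field `X` satisfies on `U` the symmetry condition `[X, A] = -A(ξ) A` with respect to
the operator `A`, where `ξ` is the component of `X` along the independent variable, which is the
first factor of the space of variables. -/
def SatisfiesSymmetryCondition {F : Type*} [NormedAddCommGroup F] [NormedSpace ℝ F]
    (A X : ℝ × F → ℝ × F) (U : Set (ℝ × F)) : Prop :=
  ∀ p ∈ U, VectorField.lieBracket ℝ X A p = -(fderiv ℝ (fun q => (X q).1) p (A p)) • A p

/-- `Z` generates a Lie point symmetry of the system `ÿ = f(x, y, ẏ)`, `(x, y, ẏ) ∈ U`. -/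
def IsPointSymmetry (f : JetSpace V → V) (U : Set (JetSpace V))
    (Z : BaseSpace V → BaseSpace V) : Prop :=
  SatisfiesSymmetryCondition (systemField f) (prolongation Z) U

/-! ### The first integration method -/

variable {m k : ℕ}

/-- The new dependent variables `s = (sⁱ, sᵝ)`, where `sⁱ` are the `m` variables along which the
generators are straightened and `sᵝ` are the remaining ones. -/
abbrev SplitSpace (m k : ℕ) := (Fin m → ℝ) × (Fin k → ℝ)

/-- `φ = (t, sⁱ, sᵝ)` is a smooth system of coordinates on an open part of `Ω` in which
the fields `Z i` have their normal form `∂/∂sⁱ`. -/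
structure IsNormalFormChart (Ω : Set (BaseSpace V)) (Z : Fin m → BaseSpace V → BaseSpace V)
    (φ : OpenPartialHomeomorph (BaseSpace V) (BaseSpace (SplitSpace m k))) : Prop where
  source_subset : φ.source ⊆ Ω
  contDiffOn : ContDiffOn ℝ ∞ φ φ.source
  contDiffOn_symm : ContDiffOn ℝ ∞ φ.symm φ.target
  normal_form : ∀ p ∈ φ.source, ∀ i, fderiv ℝ φ p (Z i p) = (0, Pi.single i 1, 0)

/-- The derivative `ṡ = ds/dt = (ds/dx) / (dt/dx)` of the new dependent variables with respect to
the new independent variable, as a function of `(x, y, ẏ)`. -/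
noncomputable def newVelocity (φ : BaseSpace V → BaseSpace (SplitSpace m k)) (j : JetSpace V) :
    SplitSpace m k :=
  (totalDeriv (fun p => (φ p).1) j)⁻¹ • totalDeriv (fun p => (φ p).2) j

/-- The space of the reduced variables `(t, sᵝ, uⁱ, ṡᵝ)`. -/
abbrev ReducedSpace (m k : ℕ) := ℝ × (Fin k → ℝ) × (Fin m → ℝ) × (Fin k → ℝ)

/-- The reduced variables `(t, sᵝ, uⁱ = ṡⁱ, ṡᵝ)` as functions of `(x, y, ẏ)`. -/
noncomputable def reducedCoords (φ : BaseSpace V → BaseSpace (SplitSpace m k)) (j : JetSpace V) :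
    ReducedSpace m k :=
  ((φ j.base).1, (φ j.base).2.2, (newVelocity φ j).1, (newVelocity φ j).2)

/-- The operator `∂_t + ṡᵝ ∂_{sᵝ} + fⁱ ∂_{uⁱ} + fᵝ ∂_{ṡᵝ}` of the reduced system
`u̇ⁱ = fⁱ(t, sᵅ, uʲ, ṡᵅ)`, `s̈ᵝ = fᵝ(t, sᵅ, uʲ, ṡᵅ)`. -/
def reducedSystemField (f : ReducedSpace m k → SplitSpace m k) (r : ReducedSpace m k) :
    ReducedSpace m k :=
  (1, r.2.2.2, (f r).1, (f r).2)

/-- In the coordinates `φ = (t, sⁱ, sᵝ)`, the part over `O` of the system `ÿ = f(x, y, ẏ)`,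
`(x, y, ẏ) ∈ U`, reads `u̇ⁱ = f'ⁱ(t, sᵅ, uʲ, ṡᵅ)`, `s̈ᵝ = f'ᵝ(t, sᵅ, uʲ, ṡᵅ)`, with `uⁱ = ṡⁱ` and
with smooth right-hand sides defined on the set `W` of all the values of the reduced variables.
The time derivative along the solutions is `d/dt = (dt/dx)⁻¹ A`. -/
structure IsReduction (f : JetSpace V → V) (U : Set (JetSpace V))
    (φ : OpenPartialHomeomorph (BaseSpace V) (BaseSpace (SplitSpace m k)))
    (O : Set (JetSpace V)) (W : Set (ReducedSpace m k))
    (f' : ReducedSpace m k → SplitSpace m k) : Prop where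
  isOpen_source : IsOpen O
  subset_domain : O ⊆ U
  base_mem : ∀ j ∈ O, j.base ∈ φ.source
  deriv_ne_zero : ∀ j ∈ O, totalDeriv (fun p => (φ p).1) j ≠ 0
  isOpen_target : IsOpen W
  image_eq : reducedCoords φ '' O = W
  contDiffOn : ContDiffOn ℝ ∞ f' W
  reduced_system : ∀ j ∈ O,
    (totalDeriv (fun p => (φ p).1) j)⁻¹ • fderiv ℝ (reducedCoords φ) j (systemField f j) =
      reducedSystemField f' (reducedCoords φ j)

/-- `Y` is the prolonged and reduced generator obtained from `Z`: the smooth vector field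
`Z⁽¹⁾(t) ∂_t + Z⁽¹⁾(sᵝ) ∂_{sᵝ} + Z⁽¹⁾(uⁱ) ∂_{uⁱ} + Z⁽¹⁾(ṡᵝ) ∂_{ṡᵝ}`, whose components
are functions of the reduced variables only, and whose components along `t` and `sᵝ` are functions
of `(t, sᵅ)` only. -/
structure IsReducedGenerator (Z : BaseSpace V → BaseSpace V)
    (φ : BaseSpace V → BaseSpace (SplitSpace m k))
    (O : Set (JetSpace V)) (W : Set (ReducedSpace m k))
    (Y : ReducedSpace m k → ReducedSpace m k) : Prop where
  contDiffOn : ContDiffOn ℝ ∞ Y W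
  pushforward : ∀ j ∈ O, fderiv ℝ (reducedCoords φ) j (prolongation Z j) = Y (reducedCoords φ j)
  point_part : ∃ ζ : BaseSpace (Fin k → ℝ) → BaseSpace (Fin k → ℝ),
    ∀ r ∈ W, ((Y r).1, (Y r).2.1) = ζ (r.1, r.2.1)

end Systems

/-! ### The smooth inverse function theorem on an open set -/

section InverseFunction

variable {E F : Type*} [NormedAddCommGroup E] [NormedSpace ℝ E] [CompleteSpace E]
  [NormedAddCommGroup F] [NormedSpace ℝ F]

/-! The algebraic input is short. The last nonzero derived algebra has zero bracket with itself,
hence is Abelian. As its nonzero elements vanish nowhere, evaluation at a point is injective on it,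
so a basis `Z i` is pointwise independent. It is an ideal, so `[Z i, X]` is a combination of the `Z
l` with constant coefficients for every generator `X`.

Normal form (`exists_isNormalFormChart`): commuting independent fields are straightened by their
joint flow. `exists_jointFlow` obtains it, smooth in times and initial point together, as the
time-one value of the curve solving the integral equation of `∑ aᵢ Zᵢ`, by the implicit function
theorem in the Banach space of curves. Commutation makes its derivative in `aᵢ` equal to `Z i`. The
map which flows out of a slice containing the direction `(1, ẏ)` is inverted to give the chart.

Inheritance (`exists_isReduction`): the reduced variables `R` are invariants of the prolonged `Z i`,
and locally every invariant is a function of them (`exists_crossSection`). This is applied to two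
maps. The first is `B = dR(A')` with `A' = (dt/dx)⁻¹ A`: the symmetry condition gives `Z i⁽¹⁾(B) = μ
B`, and the `t`-component of `B` is constantly 1, so `μ = 0` and `B` descends to the reduced system.
The second is `C = dR(X⁽¹⁾)`: since prolongation respects brackets (`lieBracket_prolongation`), `Z
i⁽¹⁾(C) = dR([Z i, X]⁽¹⁾)`, which is zero because `[Z i, X]` has constant coefficients along the
`∂/∂sˡ`; so `C` descends to the reduced generator. Brackets of `R`-related fields are `R`-related,
so the reduced bracket is a multiple of the reduced operator, and its `t`-component fixes the
multiple. -/

theorem ContDiffOn.exists_openPartialHomeomorph {f : E → F} {s : Set E} (hs : IsOpen s)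
    (hf : ContDiffOn ℝ ∞ f s) {a : E} (ha : a ∈ s) (f' : E ≃L[ℝ] F)
    (hf' : HasFDerivAt f (f' : E →L[ℝ] F) a) :
    ∃ e : OpenPartialHomeomorph E F, a ∈ e.source ∧ e.source ⊆ s ∧ (∀ x, e x = f x) ∧
      (∀ x ∈ e.source, Function.Injective (fderiv ℝ f x)) ∧ ContDiffOn ℝ ∞ e.symm e.target := by
  have hfa : ContDiffAt ℝ ∞ f a := hf.contDiffAt (hs.mem_nhds ha)
  let e₀ := hfa.toOpenPartialHomeomorph f hf' (by simp)
  -- The standard theorem gives smoothness of the inverse only at the image of `a`. Restricting to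
  -- the open set where the derivative stays invertible gives it on the whole target.
  let t : Set E := s ∩ fderiv ℝ f ⁻¹' Set.range ((↑) : (E ≃L[ℝ] F) → E →L[ℝ] F)
  have ht : IsOpen t := (hf.continuousOn_fderiv_of_isOpen hs (by simp)).isOpen_inter_preimage hs
    ContinuousLinearEquiv.isOpen
  refine ⟨e₀.restrOpen t ht, ⟨hfa.mem_toOpenPartialHomeomorph_source hf' (by simp), ha, f', ?_⟩,
    fun x hx => hx.2.1, fun x => ?_, fun x hx => ?_, fun y hy => ?_⟩
  · exact hf'.fderiv.symm
  · exact congrFun (hfa.toOpenPartialHomeomorph_coe hf' (by simp)) x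
  · obtain ⟨g, hg⟩ := hx.2.2
    rw [← hg]
    exact g.injective
  · have hx : (e₀.restrOpen t ht).symm y ∈ (e₀.restrOpen t ht).source :=
      (e₀.restrOpen t ht).map_target hy
    obtain ⟨g, hg⟩ := hx.2.2
    have hfx := hf.contDiffAt (hs.mem_nhds hx.2.1)
    refine ((e₀.restrOpen t ht).contDiffAt_symm (f₀' := g) hy ?_ hfx).contDiffWithinAt
    rw [hg]
    exact (hfx.differentiableAt (by simp)).hasFDerivAt

end InverseFunction

/-! ### Superposition operators on spaces of continuous functions -/

section Superposition

section Continuous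

variable {K E F : Type*} [TopologicalSpace K] [TopologicalSpace E] [TopologicalSpace F] [Zero F]

open Classical in
/-- The superposition operator `γ ↦ f ∘ γ`. -/
noncomputable def superposition (f : E → F) (γ : C(K, E)) : C(K, F) :=
  if hf : Continuous f then (⟨f, hf⟩ : C(E, F)).comp γ else 0

lemma superposition_apply {f : E → F} (hf : Continuous f) (γ : C(K, E)) (t : K) :
    superposition f γ t = f (γ t) := by
  simp [superposition, hf]

lemma continuous_superposition {f : E → F} (hf : Continuous f) :
    Continuous (superposition (K := K) f) := by
  have : superposition (K := K) f = fun γ => (⟨f, hf⟩ : C(E, F)).comp γ := by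
    ext γ t; simp [superposition, hf]
  rw [this]
  exact ContinuousMap.continuous_postcomp _

end Continuous

variable {K : Type*} [TopologicalSpace K] [CompactSpace K]
  {E F : Type*} [NormedAddCommGroup E] [NormedSpace ℝ E] [NormedAddCommGroup F] [NormedSpace ℝ F]

/-- The action of a continuous family of continuous linear maps on continuous functions. -/
noncomputable def pointwiseApply : C(K, E →L[ℝ] F) →L[ℝ] C(K, E) →L[ℝ] C(K, F) :=
  LinearMap.mkContinuous₂
    (LinearMap.mk₂ ℝ (fun (A : C(K, E →L[ℝ] F)) (h : C(K, E)) =>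
        (⟨fun t => A t (h t), by fun_prop⟩ : C(K, F)))
      (fun _ _ _ => rfl) (fun _ _ _ => rfl)
      (fun A h h' => by ext t; exact map_add (A t) _ _)
      (fun c A h => by ext t; exact map_smul (A t) c _)) 1 fun A h => by
    rw [one_mul, ContinuousMap.norm_le _ (by positivity)]
    exact fun t => (A t).le_of_opNorm_le_of_le (A.norm_coe_le_norm t) (h.norm_coe_le_norm t)

lemma pointwiseApply_apply (A : C(K, E →L[ℝ] F)) (h : C(K, E)) (t : K) :
    pointwiseApply A h t = A t (h t) := rfl

/-- The mean value inequality on the segment from `γ t` to `γ t + h t` bounds the remainder at each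
`t`. The bound is uniform in `t` because `γ ↦ f' ∘ γ` is continuous in the sup norm. -/
lemma hasFDerivAt_superposition {f : E → F} (hf : ContDiff ℝ 1 f) (γ : C(K, E)) :
    HasFDerivAt (superposition f) (pointwiseApply (superposition (fderiv ℝ f) γ)) γ := by
  have hdf : Continuous (fderiv ℝ f) := hf.continuous_fderiv (by simp)
  have hdiff : Differentiable ℝ f := hf.differentiable (by simp)
  rw [hasFDerivAt_iff_isLittleO_nhds_zero, Asymptotics.isLittleO_iff]
  intro ε hε
  have hcont : ContinuousAt (superposition (K := K) (fderiv ℝ f)) γ :=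
    (continuous_superposition hdf).continuousAt
  obtain ⟨δ, hδ, hball⟩ := (Metric.continuousAt_iff (α := C(K, E))
    (β := C(K, E →L[ℝ] F))).1 hcont ε hε
  filter_upwards [Metric.ball_mem_nhds (0 : C(K, E)) hδ] with h hh
  rw [ContinuousMap.norm_le _ (by positivity)]
  intro t
  have key : ∀ x ∈ segment ℝ (γ t) (γ t + h t), ‖fderiv ℝ f x - fderiv ℝ f (γ t)‖ ≤ ε := by
    intro x hx
    rw [segment_eq_image'] at hx
    obtain ⟨θ, hθ, rfl⟩ := hx
    have h1 : dist (γ + θ • h) γ < δ := by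
      rw [dist_eq_norm, add_sub_cancel_left, norm_smul, Real.norm_of_nonneg hθ.1]
      calc θ * ‖h‖ ≤ 1 * ‖h‖ := by gcongr; exact hθ.2
        _ < δ := by simpa using hh
    have h2 := (ContinuousMap.dist_apply_le_dist t).trans (hball h1).le
    rw [superposition_apply hdf, superposition_apply hdf, dist_eq_norm] at h2
    simpa using h2
  have := (convex_segment (𝕜 := ℝ) (γ t) (γ t + h t)).norm_image_sub_le_of_norm_fderiv_le'
    (fun x _ => hdiff x) key (left_mem_segment ℝ _ _) (right_mem_segment ℝ _ _)
  simp only [ContinuousMap.sub_apply, superposition_apply hf.continuous, ContinuousMap.add_apply,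
    pointwiseApply_apply, superposition_apply hdf]
  refine (by simpa using this : _ ≤ ε * ‖h t‖).trans ?_
  gcongr
  exact h.norm_coe_le_norm t

end Superposition

theorem contDiff_superposition {K : Type*} [TopologicalSpace K] [CompactSpace K] {E : Type*}
    [NormedAddCommGroup E] [NormedSpace ℝ E] {f : E → E} (hf : ContDiff ℝ ∞ f) :
    ContDiff ℝ ∞ (superposition (K := K) f) := by
  -- The derivative is again a superposition operator, of `fderiv ℝ f`, followed by a continuous
  -- linear map. Its values lie in `E →L[ℝ] F`, so the induction must range over all target spaces.
  suffices ∀ (n : ℕ) {F : Type _} [NormedAddCommGroup F] [NormedSpace ℝ F] (f : E → F),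
      ContDiff ℝ ∞ f → ContDiff ℝ n (superposition (K := K) f) from
    contDiff_infty.2 fun n => this n f hf
  intro n
  induction n with
  | zero =>
    intro F _ _ f hf
    exact contDiff_zero.2 (continuous_superposition hf.continuous)
  | succ n ih =>
    intro F _ _ f hf
    have h1 : ContDiff ℝ 1 f := hf.of_le (by simp)
    have hfd : fderiv ℝ (superposition (K := K) f) =
        fun γ => pointwiseApply (superposition (fderiv ℝ f) γ) :=
      funext fun γ => (hasFDerivAt_superposition h1 γ).fderiv
    push_cast
    refine contDiff_succ_iff_fderiv.2
      ⟨fun γ => (hasFDerivAt_superposition h1 γ).differentiableAt, by simp, ?_⟩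
    rw [hfd]
    exact pointwiseApply.contDiff.comp (ih _ (contDiff_infty_iff_fderiv.1 hf).2)

/-! ### The primitive of a continuous function on the unit interval -/

section Primitive

variable {E : Type*} [NormedAddCommGroup E] [NormedSpace ℝ E]

/-- The primitive which vanishes at `0` of a continuous function on the unit interval. -/
noncomputable def unitPrimitive : C(unitInterval, E) →L[ℝ] C(unitInterval, E) :=
  LinearMap.mkContinuous
    { toFun := fun γ => ⟨fun t => ∫ σ in (0 : ℝ)..t, γ (Set.projIcc 0 1 zero_le_one σ),
        (intervalIntegral.continuous_primitive
          (fun _ _ => Continuous.intervalIntegrable (by fun_prop) _ _) 0).comp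
            continuous_subtype_val⟩
      map_add' := fun γ γ' => by
        ext t
        exact intervalIntegral.integral_add (Continuous.intervalIntegrable (by fun_prop) _ _)
          (Continuous.intervalIntegrable (by fun_prop) _ _)
      map_smul' := fun c γ => by
        ext t
        exact intervalIntegral.integral_smul c _ } 1 fun γ => by
    rw [one_mul, ContinuousMap.norm_le _ (by positivity)]
    intro t
    refine (intervalIntegral.norm_integral_le_of_norm_le_const
      fun σ _ => γ.norm_coe_le_norm _).trans ?_
    rw [sub_zero, abs_of_nonneg t.2.1]
    exact mul_le_of_le_one_right (norm_nonneg _) t.2.2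

lemma unitPrimitive_apply (γ : C(unitInterval, E)) (t : unitInterval) :
    unitPrimitive γ t = ∫ σ in (0 : ℝ)..t, γ (Set.projIcc 0 1 zero_le_one σ) := rfl

end Primitive

/-! ### The joint flow of commuting vector fields -/

section JointFlow

variable {E : Type*} [NormedAddCommGroup E] [NormedSpace ℝ E] {m : ℕ}

/-- The defect of the integral equation `γ(τ) = q + ∫₀^τ ∑ aᵢ Zᵢ(γ)` of the integral curves of
`∑ aᵢ Zᵢ` starting at `q`. -/
noncomputable def flowDefect (Z : Fin m → E → E)
    (u : ((Fin m → ℝ) × E) × C(unitInterval, E)) : C(unitInterval, E) :=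
  u.2 - ContinuousLinearMap.const ℝ unitInterval u.1.2 -
    unitPrimitive (∑ i, u.1.1 i • superposition (Z i) u.2)

lemma contDiff_flowDefect {Z : Fin m → E → E} (hZ : ∀ i, ContDiff ℝ ∞ (Z i)) :
    ContDiff ℝ ∞ (flowDefect Z) := by
  have h := fun i => contDiff_superposition (K := unitInterval) (hZ i)
  unfold flowDefect
  have h1 : ContDiff ℝ ∞ fun u : ((Fin m → ℝ) × E) × C(unitInterval, E) =>
      ∑ i, u.1.1 i • superposition (Z i) u.2 :=
    ContDiff.sum fun i _ => ContDiff.smul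
      ((contDiff_apply ℝ ℝ i).comp (contDiff_fst.comp contDiff_fst)) ((h i).comp contDiff_snd)
  exact (contDiff_snd.sub ((ContinuousLinearMap.const ℝ unitInterval).contDiff.comp
    (contDiff_snd.comp contDiff_fst))).sub (unitPrimitive.contDiff.comp h1)

lemma fderiv_flowDefect {Z : Fin m → E → E} (hZ : ∀ i, ContDiff ℝ ∞ (Z i))
    (u v : ((Fin m → ℝ) × E) × C(unitInterval, E)) :
    fderiv ℝ (flowDefect Z) u v =
      v.2 - ContinuousLinearMap.const ℝ unitInterval v.1.2 -
        unitPrimitive (∑ i, (v.1.1 i • superposition (Z i) u.2 +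
          u.1.1 i • pointwiseApply (superposition (fderiv ℝ (Z i)) u.2) v.2)) := by
  let π (i : Fin m) : ((Fin m → ℝ) × E) × C(unitInterval, E) →L[ℝ] ℝ :=
    ContinuousLinearMap.proj i ∘L ContinuousLinearMap.fst ℝ _ _ ∘L ContinuousLinearMap.fst ℝ _ _
  have hπ (i : Fin m) : HasFDerivAt (fun u : ((Fin m → ℝ) × E) × C(unitInterval, E) => u.1.1 i)
      (π i) u := (π i).hasFDerivAt
  have hsup (i : Fin m) : HasFDerivAt (fun u : ((Fin m → ℝ) × E) × C(unitInterval, E) =>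
      superposition (Z i) u.2) _ u :=
    (hasFDerivAt_superposition ((hZ i).of_le (by simp)) u.2).comp u hasFDerivAt_snd
  have h (i : Fin m) := (hπ i).fun_smul (hsup i)
  have h2 := (hasFDerivAt_snd.sub
    (((ContinuousLinearMap.const ℝ unitInterval (M := E)).hasFDerivAt).comp u
    (hasFDerivAt_snd.comp u hasFDerivAt_fst))).sub
      ((unitPrimitive (E := E)).hasFDerivAt.comp u
        (HasFDerivAt.fun_sum (u := Finset.univ) fun i _ => h i))
  have h3 := h2.fderiv
  change fderiv ℝ (flowDefect Z) u = _ at h3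
  rw [h3]
  simp only [sub_apply, ContinuousLinearMap.comp_apply,
    sum_apply, add_apply, smul_apply,
    ContinuousLinearMap.smulRight_apply]
  congr 2
  refine Finset.sum_congr rfl fun i _ => ?_
  rw [add_comm]
  rfl

/-- The variation of the integral curve of `∑ aᵢ Zᵢ` with respect to `aᵢ` is `τ Zᵢ` when the fields
commute. -/
lemma variation_of_integralCurve [CompleteSpace E] {Z : Fin m → E → E}
    (hZ : ∀ i, ContDiff ℝ ∞ (Z i))
    {a : Fin m → ℝ} {q : E} {γ : C(unitInterval, E)} (hγ : flowDefect Z ((a, q), γ) = 0)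
    (hcomm : ∀ t i j, VectorField.lieBracket ℝ (Z i) (Z j) (γ t) = 0) (i : Fin m) :
    fderiv ℝ (flowDefect Z) ((a, q), γ)
      ((Pi.single i 1, 0), ⟨fun t => (t : ℝ) • Z i (γ t),
        continuous_subtype_val.smul ((hZ i).continuous.comp γ.continuous)⟩) = 0 := by
  have hdiff (i) : Differentiable ℝ (Z i) := (hZ i).differentiable (by simp)
  have hcd (i) : Continuous (fderiv ℝ (Z i)) := (hZ i).continuous_fderiv (by simp)
  have hc (i) : Continuous (Z i) := (hZ i).continuous
  set pr : ℝ → unitInterval := Set.projIcc 0 1 zero_le_one with hpr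
  have hprc : Continuous pr := continuous_projIcc
  -- The right-hand side of the integral equation extends `γ` to a curve differentiable on all of
  -- `ℝ`, so that `σ • Z i (c σ)` can be differentiated and integrated back.
  set c : ℝ → E := fun σ => q + ∫ r in (0 : ℝ)..σ, ∑ k, a k • Z k (γ (pr r)) with hcdef
  have hXc : Continuous fun r => ∑ k, a k • Z k (γ (pr r)) := by fun_prop
  have hcderiv (σ : ℝ) : HasDerivAt c (∑ k, a k • Z k (γ (pr σ))) σ :=
    (intervalIntegral.integral_hasDerivAt_right (hXc.intervalIntegrable _ _)
      (hXc.stronglyMeasurableAtFilter _ _) hXc.continuousAt).const_add q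
  have hcγ (t : unitInterval) : γ t = c t := by
    have := congrArg (fun δ : C(unitInterval, E) => δ t) hγ
    simp only [flowDefect, ContinuousMap.sub_apply, unitPrimitive_apply,
      ContinuousMap.sum_apply, ContinuousMap.smul_apply, superposition_apply (hc _),
      ContinuousMap.zero_apply] at this
    rw [sub_sub, sub_eq_zero] at this
    exact this
  have hcc : Continuous c := continuous_iff_continuousAt.2 fun σ => (hcderiv σ).continuousAt
  have hderiv (σ : ℝ) : HasDerivAt (fun σ => σ • Z i (c σ))
      (σ • fderiv ℝ (Z i) (c σ) (∑ k, a k • Z k (γ (pr σ))) + (1 : ℝ) • Z i (c σ)) σ :=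
    (hasDerivAt_id σ).smul ((hdiff i _).hasFDerivAt.comp_hasDerivAt σ (hcderiv σ))
  ext t
  rw [fderiv_flowDefect hZ]
  simp only [ContinuousMap.sub_apply, unitPrimitive_apply, ContinuousMap.sum_apply,
    ContinuousMap.add_apply, ContinuousMap.smul_apply, superposition_apply (hc _),
    superposition_apply (hcd _), pointwiseApply_apply, ContinuousMap.zero_apply, map_zero,
    sub_zero, ContinuousMap.coe_mk]
  rw [sub_eq_zero]
  have hint := intervalIntegral.integral_eq_sub_of_hasDerivAt (a := 0) (b := (t : ℝ))
    (fun σ _ => hderiv σ) (Continuous.intervalIntegrable (by fun_prop) _ _)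
  rw [zero_smul, sub_zero, ← hcγ] at hint
  rw [← hint]
  refine intervalIntegral.integral_congr fun σ hσ => ?_
  rw [Set.uIcc_of_le t.2.1] at hσ
  have hσ' : σ ∈ Set.Icc (0 : ℝ) 1 := ⟨hσ.1, hσ.2.trans t.2.2⟩
  have hprσ : pr σ = ⟨σ, hσ'⟩ := Set.projIcc_of_mem _ hσ'
  have hcσ : c σ = γ (pr σ) := by rw [hprσ, hcγ]
  simp only [Finset.sum_add_distrib, Pi.single_apply, ite_smul, one_smul, zero_smul,
    Finset.sum_ite_eq', Finset.mem_univ, if_true]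
  rw [← hpr, hcσ, add_comm, map_sum, Finset.smul_sum]
  congr 1
  refine Finset.sum_congr rfl fun k _ => ?_
  -- The only use of commutation: `DZᵢ(Z_k) = DZ_k(Zᵢ)` turns the derivative of `σ Zᵢ(c σ)` into the
  -- integrand of the linearised equation.
  have hb := hcomm (pr σ) i k
  rw [VectorField.lieBracket, sub_eq_zero] at hb
  rw [map_smul, map_smul, hb, hprσ, smul_comm]

/-- The implicit function theorem for `flowDefect`, applied at the constant curve `p`, yields curves
depending smoothly on `(a, q)`; evaluation at time 1 is the flow. The time is fixed and the
coefficients `a` vary, which treats all the flows at once. -/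
theorem exists_jointFlow [CompleteSpace E] {Z : Fin m → E → E} (hZ : ∀ i, ContDiff ℝ ∞ (Z i))
    {p : E} (hcomm : ∀ᶠ x in nhds p, ∀ i j, VectorField.lieBracket ℝ (Z i) (Z j) x = 0) :
    ∃ (Ψ : (Fin m → ℝ) × E → E) (s : Set ((Fin m → ℝ) × E)), IsOpen s ∧ (0, p) ∈ s ∧
      ContDiffOn ℝ ∞ Ψ s ∧ (∀ q, (0, q) ∈ s → Ψ (0, q) = q) ∧
      ∀ z ∈ s, ∀ i, fderiv ℝ Ψ z (Pi.single i 1, 0) = Z i (Ψ z) := by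
  let Θ : ((Fin m → ℝ) × E) × C(unitInterval, E) → ((Fin m → ℝ) × E) × C(unitInterval, E) :=
    fun u => (u.1, flowDefect Z u)
  have hΘ : ContDiff ℝ ∞ Θ := contDiff_fst.prodMk (contDiff_flowDefect hZ)
  have hΘfd (u v) : fderiv ℝ Θ u v = (v.1, fderiv ℝ (flowDefect Z) u v) := by
    have h := hasFDerivAt_fst.prodMk
      (((contDiff_flowDefect hZ).differentiable (by simp)) u).hasFDerivAt (𝕜 := ℝ)
    rw [show fderiv ℝ Θ u = _ from h.fderiv]
    rfl
  let cp : C(unitInterval, E) := ContinuousLinearMap.const ℝ unitInterval p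
  let u₀ : ((Fin m → ℝ) × E) × C(unitInterval, E) := ((0, p), cp)
  obtain ⟨r, hr, hball⟩ := Metric.eventually_nhds_iff.1 hcomm
  have hu₀ : Θ u₀ = ((0, p), 0) := by
    simp [Θ, flowDefect, u₀, cp]
  let B : (Fin m → ℝ) × E →L[ℝ] C(unitInterval, E) :=
    ContinuousLinearMap.const ℝ unitInterval ∘L ContinuousLinearMap.snd ℝ _ _ +
      ∑ i, ((ContinuousLinearMap.proj (R := ℝ) i ∘L
        ContinuousLinearMap.fst ℝ (Fin m → ℝ) E).smulRight
        (unitPrimitive (superposition (Z i) cp)))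
  -- At `a = 0` the terms with `DZᵢ` drop out of the linearisation, which becomes block triangular
  -- with identity diagonal; its inverse is obtained by changing the sign of `B`.
  let Θ' : (((Fin m → ℝ) × E) × C(unitInterval, E)) ≃L[ℝ] ((Fin m → ℝ) × E) × C(unitInterval, E) :=
    ContinuousLinearEquiv.equivOfInverse
      ((ContinuousLinearMap.fst ℝ _ _).prod
        (ContinuousLinearMap.snd ℝ _ _ - B ∘L ContinuousLinearMap.fst ℝ _ _))
      ((ContinuousLinearMap.fst ℝ _ _).prod
        (ContinuousLinearMap.snd ℝ _ _ + B ∘L ContinuousLinearMap.fst ℝ _ _))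
      (fun v => by simp) (fun v => by simp)
  have hΘ' : HasFDerivAt Θ (Θ' : _ →L[ℝ] _) u₀ := by
    have h := (hΘ.differentiable (by simp) u₀).hasFDerivAt
    have hfd : fderiv ℝ Θ u₀ = (Θ' : _ →L[ℝ] _) := ContinuousLinearMap.ext fun v => ?_
    · rwa [hfd] at h
    rw [hΘfd, fderiv_flowDefect hZ]
    simp [Θ', B, u₀, sub_sub]
  obtain ⟨e, hu₀e, -, hecoe, hinj, hesymm⟩ :=
    ContDiffOn.exists_openPartialHomeomorph isOpen_univ hΘ.contDiffOn (Set.mem_univ u₀) Θ' hΘ'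
  let S : (Fin m → ℝ) × E → ((Fin m → ℝ) × E) × C(unitInterval, E) := fun z => e.symm (z, 0)
  let s₀ : Set ((Fin m → ℝ) × E) := (fun z => (z, (0 : C(unitInterval, E)))) ⁻¹' e.target
  have hs₀ : IsOpen s₀ := e.open_target.preimage (by fun_prop)
  have hS : ContDiffOn ℝ ∞ S s₀ := hesymm.comp (by fun_prop) fun z hz => hz
  -- The whole curve, not only its endpoint, must stay in the ball where the fields commute.
  let s : Set ((Fin m → ℝ) × E) := s₀ ∩ S ⁻¹' (Prod.snd ⁻¹' Metric.ball cp r)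
  have hs : IsOpen s := hS.continuousOn.isOpen_inter_preimage hs₀
    (Metric.isOpen_ball.preimage continuous_snd)
  have hΘS : ∀ z ∈ s₀, Θ (S z) = (z, 0) := fun z hz => by
    rw [← hecoe]; exact e.right_inv hz
  have hS1 : ∀ z ∈ s₀, (S z).1 = z := fun z hz => congrArg Prod.fst (hΘS z hz)
  have hS2 : ∀ z ∈ s₀, flowDefect Z (z, (S z).2) = 0 := fun z hz => by
    have := congrArg Prod.snd (hΘS z hz)
    simp only [Θ] at this
    rw [← this, show S z = (z, (S z).2) from Prod.ext (hS1 z hz) rfl]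
  have hS0 : (0, p) ∈ s₀ ∧ S (0, p) = u₀ := by
    have h1 := e.map_source hu₀e
    have h2 := e.left_inv hu₀e
    rw [hecoe, hu₀] at h1 h2
    exact ⟨h1, h2⟩
  have hSs : ContDiffOn ℝ ∞ S s := hS.mono Set.inter_subset_left
  let ev : ((Fin m → ℝ) × E) × C(unitInterval, E) →L[ℝ] E :=
    ContinuousMap.evalCLM ℝ 1 ∘L ContinuousLinearMap.snd ℝ _ _
  refine ⟨fun z => ev (S z), s, hs, ⟨hS0.1, ?_⟩, ev.contDiff.comp_contDiffOn hSs, fun q hq => ?_,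
    fun z hz i => ?_⟩
  · simp [hS0.2, u₀, hr]
  · have h := hS2 (0, q) hq.1
    simp only [flowDefect, Pi.zero_apply, zero_smul, Finset.sum_const_zero, map_zero, sub_zero,
      sub_eq_zero] at h
    change (S (0, q)).2 1 = q
    rw [h]
    rfl
  · have hSd : DifferentiableAt ℝ S z :=
      (hSs.contDiffAt (hs.mem_nhds hz)).differentiableAt (by simp)
    have hcz : ∀ t i j, VectorField.lieBracket ℝ (Z i) (Z j) ((S z).2 t) = 0 := fun t =>
      hball (lt_of_le_of_lt (ContinuousMap.dist_apply_le_dist t (g := cp)) hz.2)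
    let η : C(unitInterval, E) := ⟨fun t => (t : ℝ) • Z i ((S z).2 t),
      continuous_subtype_val.smul ((hZ i).continuous.comp (S z).2.continuous)⟩
    have hvar : fderiv ℝ (flowDefect Z) (z, (S z).2) ((Pi.single i 1, 0), η) = 0 :=
      variation_of_integralCurve hZ (hS2 z hz.1) hcz i
    have hchain : fderiv ℝ Θ (S z) (fderiv ℝ S z (Pi.single i 1, 0)) = ((Pi.single i 1, 0), 0) := by
      have h1 := ((hΘ.differentiable (by simp) (S z)).hasFDerivAt.comp z hSd.hasFDerivAt)
      have h2 : HasFDerivAt (Θ ∘ S)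
          (ContinuousLinearMap.inl ℝ ((Fin m → ℝ) × E) C(unitInterval, E)) z :=
        (ContinuousLinearMap.inl ℝ ((Fin m → ℝ) × E) C(unitInterval, E)).hasFDerivAt
          |>.congr_of_eventuallyEq
          (Filter.eventually_of_mem (hs₀.mem_nhds hz.1) hΘS)
      have := congrArg (fun A : _ →L[ℝ] _ => A (Pi.single i 1, 0)) (h1.unique h2)
      exact this
    have hSe : S z ∈ e.source := e.map_target hz.1
    have hSz : S z = (z, (S z).2) := Prod.ext (hS1 z hz.1) rfl
    have hη : fderiv ℝ Θ (S z) ((Pi.single i 1, 0), η) = ((Pi.single i 1, 0), 0) := by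
      rw [hΘfd, hSz, hvar]
    -- Both `dS(eᵢ)` and the explicit variation `τ Zᵢ` are sent by the injective `dΘ` to the same
    -- vector, so they agree.
    have heq := hinj _ hSe (hchain.trans hη.symm)
    have h3 : fderiv ℝ (fun z => ev (S z)) z = ev ∘L fderiv ℝ S z :=
      (ev.hasFDerivAt.comp z hSd.hasFDerivAt).fderiv
    rw [h3, ContinuousLinearMap.comp_apply, heq]
    change ((1 : unitInterval) : ℝ) • Z i ((S z).2 1) = _
    rw [Set.Icc.coe_one, one_smul]
    rfl

end JointFlow

/-! ### Charts in which commuting vector fields are coordinate fields -/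

section Straightening

/-- Multiplication by a bump function. The superposition operators require fields defined and smooth
everywhere, whereas those of the theorem are smooth only on `Ω`. -/
lemma ContDiffOn.exists_contDiff_eqOn_nhds {E F : Type*} [NormedAddCommGroup E] [NormedSpace ℝ E]
    [FiniteDimensional ℝ E] [NormedAddCommGroup F] [NormedSpace ℝ F] {f : E → F} {s : Set E}
    (hs : IsOpen s) (hf : ContDiffOn ℝ ∞ f s) {p : E} (hp : p ∈ s) :
    ∃ g : E → F, ContDiff ℝ ∞ g ∧ g =ᶠ[nhds p] f := by
  obtain ⟨r, hr, hrs⟩ := Metric.isOpen_iff.1 hs p hp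
  let χ : ContDiffBump p := ⟨r / 4, r / 2, by linarith, by linarith⟩
  refine ⟨fun x => χ x • f x, contDiff_iff_contDiffAt.2 fun x => ?_, ?_⟩
  · by_cases hx : x ∈ s
    · exact χ.contDiff.contDiffAt.smul (hf.contDiffAt (hs.mem_nhds hx))
    · have hx' : x ∉ tsupport χ := fun h => hx (hrs (by
        rw [χ.tsupport_eq] at h
        exact Metric.closedBall_subset_ball (by simp only [χ]; linarith) h))
      refine (contDiffAt_const (c := (0 : F))).congr_of_eventuallyEq ?_
      filter_upwards [notMem_tsupport_iff_eventuallyEq.1 hx'] with y hy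
      simp [hy]
  · filter_upwards [χ.eventuallyEq_one] with y hy
    simp [hy]

/-- Completes `w` and the `v i` to a basis. Using `w = (1, ẏ)` as the `t`-axis will make `dt/dx`
nonzero. -/
lemma LinearIndependent.exists_linearEquiv_prod {B : Type*} [AddCommGroup B] [Module ℝ B]
    [FiniteDimensional ℝ B] {m : ℕ} {v : Fin m → B} (hv : LinearIndependent ℝ v) {w : B}
    (hw : w ∉ Submodule.span ℝ (Set.range v)) :
    ∃ (k : ℕ) (L : BaseSpace (SplitSpace m k) ≃ₗ[ℝ] B), L (1, 0) = w ∧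
      ∀ i, L (0, Pi.single i 1, 0) = v i := by
  let L₀ : ℝ × (Fin m → ℝ) →ₗ[ℝ] B :=
    (LinearMap.toSpanSingleton ℝ B w).coprod (Fintype.linearCombination ℝ v)
  have hL₀ : Function.Injective L₀ := by
    rw [← LinearMap.ker_eq_bot, LinearMap.ker_eq_bot']
    rintro ⟨c, a⟩ h
    have h' : c • w + Fintype.linearCombination ℝ v a = 0 := h
    have hc : c = 0 := by
      by_contra hc
      refine hw ?_
      have : w = -(c⁻¹ • Fintype.linearCombination ℝ v a) := by
        rw [eq_neg_of_add_eq_zero_right h', smul_neg, neg_neg, smul_smul, inv_mul_cancel₀ hc,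
          one_smul]
      rw [this, ← Fintype.range_linearCombination]
      exact Submodule.neg_mem _ (Submodule.smul_mem _ _ (LinearMap.mem_range_self _ _))
    subst hc
    rw [zero_smul, zero_add] at h'
    have ha := Fintype.linearIndependent_iff.1 hv a
      (by simpa [Fintype.linearCombination_apply] using h')
    exact Prod.ext rfl (funext ha)
  obtain ⟨C, hC⟩ := (LinearMap.range L₀).exists_isCompl
  let L := ((LinearEquiv.prodAssoc ℝ ℝ (Fin m → ℝ) (Fin (Module.finrank ℝ C) → ℝ)).symm.trans
    ((LinearEquiv.ofInjective L₀ hL₀).prodCongr (Module.finBasis ℝ C).equivFun.symm)).trans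
      (Submodule.prodEquivOfIsCompl _ _ hC)
  have hL (c a) : L (c, a, 0) = c • w + Fintype.linearCombination ℝ v a := by
    have hA : (LinearEquiv.prodAssoc ℝ ℝ (Fin m → ℝ) (Fin (Module.finrank ℝ C) → ℝ)).symm
      (c, a, 0) = ((c, a), 0) := rfl
    simp [L, L₀, hA]
  refine ⟨_, L, ?_, fun i => ?_⟩
  · have := hL 1 0
    rwa [one_smul, map_zero, add_zero] at this
  · rw [hL]
    simp

theorem exists_isNormalFormChart {V : Type*} [NormedAddCommGroup V] [NormedSpace ℝ V]
    [FiniteDimensional ℝ V] {m : ℕ} {Ω : Set (BaseSpace V)} (hΩ : IsOpen Ω)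
    {Z : Fin m → BaseSpace V → BaseSpace V} (hZ : ∀ i, ContDiffOn ℝ ∞ (Z i) Ω)
    (hcomm : ∀ p ∈ Ω, ∀ i j, VectorField.lieBracket ℝ (Z i) (Z j) p = 0)
    {j : JetSpace V} (hj : j.base ∈ Ω) (hindep : LinearIndependent ℝ fun i => Z i j.base)
    (hspan : (1, j.2.2) ∉ Submodule.span ℝ (Set.range fun i => Z i j.base)) :
    ∃ (k : ℕ) (φ : OpenPartialHomeomorph (BaseSpace V) (BaseSpace (SplitSpace m k))),
      IsNormalFormChart Ω Z φ ∧ j.base ∈ φ.source ∧ totalDeriv (fun p => (φ p).1) j ≠ 0 := by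
  have : CompleteSpace V := FiniteDimensional.complete ℝ V
  choose X hX hXZ using fun i => (hZ i).exists_contDiff_eqOn_nhds hΩ hj
  have hev : ∀ᶠ x in nhds j.base, x ∈ Ω ∧ ∀ i, X i =ᶠ[nhds x] Z i :=
    Filter.Eventually.and (hΩ.mem_nhds hj)
      (Filter.eventually_all.2 fun i => (hXZ i).eventuallyEq_nhds)
  obtain ⟨Ω', hΩ', hΩ'o, hjΩ'⟩ := eventually_nhds_iff.1 hev
  obtain ⟨Ψ, s, hs, hjs, hΨ, hΨ0, hΨd⟩ := exists_jointFlow hX (p := j.base) (by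
    filter_upwards [hev] with x hx i i'
    rw [(hx.2 i).lieBracket_vectorField_eq (hx.2 i')]
    exact hcomm x hx.1 i i')
  obtain ⟨k, L₀, hLw, hLv⟩ := hindep.exists_linearEquiv_prod hspan
  let L : BaseSpace (SplitSpace m k) ≃L[ℝ] BaseSpace V := L₀.toContinuousLinearEquiv
  let π : BaseSpace (SplitSpace m k) →L[ℝ] (Fin m → ℝ) × BaseSpace V :=
    (ContinuousLinearMap.fst ℝ _ _ ∘L ContinuousLinearMap.snd ℝ _ _).prod
      ((L : _ →L[ℝ] _) ∘L (ContinuousLinearMap.fst ℝ _ _).prod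
        ((0 : _ →L[ℝ] (Fin m → ℝ)).prod
          (ContinuousLinearMap.snd ℝ _ _ ∘L ContinuousLinearMap.snd ℝ _ _)))
  have hπ (t a b) : π (t, a, b) = (a, L (t, 0, b)) := rfl
  -- `Ψ ∘ κ` flows for times `a` from the slice point `j.base + L (t, 0, b)`. Its derivative in `aᵢ`
  -- is `Z i`, and its derivative at the origin is `L`.
  let κ : BaseSpace (SplitSpace m k) → (Fin m → ℝ) × BaseSpace V := fun x => (0, j.base) + π x
  have hκ : ContDiff ℝ ∞ κ := contDiff_const.add π.contDiff
  have hκd (x) : HasFDerivAt κ π x := π.hasFDerivAt.const_add _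
  have hκ0 : κ 0 = (0, j.base) := by simp [κ]
  have hs₁ : IsOpen (κ ⁻¹' s) := hs.preimage hκ.continuous
  have hψ₁ : ContDiffOn ℝ ∞ (Ψ ∘ κ) (κ ⁻¹' s) := hΨ.comp hκ.contDiffOn fun _ h => h
  let s₂ := κ ⁻¹' s ∩ (Ψ ∘ κ) ⁻¹' Ω'
  have hs₂ : IsOpen s₂ := hψ₁.continuousOn.isOpen_inter_preimage hs₁ hΩ'o
  have hψ : ContDiffOn ℝ ∞ (Ψ ∘ κ) s₂ := hψ₁.mono Set.inter_subset_left
  have hψ0 : (Ψ ∘ κ) 0 = j.base := by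
    rw [Function.comp_apply, hκ0]
    exact hΨ0 _ hjs
  have h0 : (0 : BaseSpace (SplitSpace m k)) ∈ s₂ :=
    ⟨by rwa [Set.mem_preimage, hκ0], by rwa [Set.mem_preimage, hψ0]⟩
  have hΨda (z) (hz : z ∈ s) : DifferentiableAt ℝ Ψ z :=
    (hΨ.contDiffAt (hs.mem_nhds hz)).differentiableAt (by simp)
  have hψd (x) (hx : x ∈ s₂) : HasFDerivAt (Ψ ∘ κ) (fderiv ℝ Ψ (κ x) ∘L π) x :=
    (hΨda _ hx.1).hasFDerivAt.comp x (hκd x)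
  have hψi (x) (hx : x ∈ s₂) (i : Fin m) :
      fderiv ℝ (Ψ ∘ κ) x (0, Pi.single i 1, 0) = Z i ((Ψ ∘ κ) x) := by
    rw [(hψd x hx).fderiv, ContinuousLinearMap.comp_apply, hπ,
      show ((0 : ℝ), (0 : Fin m → ℝ), (0 : Fin k → ℝ)) = 0 from rfl, map_zero, hΨd _ hx.1]
    exact ((hΩ' _ hx.2).2 i).eq_of_nhds
  have hΨq (w : BaseSpace V) : fderiv ℝ Ψ (0, j.base) (0, w) = w := by
    have h1 : HasFDerivAt (fun q => Ψ (0, q))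
        (fderiv ℝ Ψ (0, j.base) ∘L ContinuousLinearMap.inr ℝ (Fin m → ℝ) (BaseSpace V)) j.base :=
      (hΨda _ hjs).hasFDerivAt.comp j.base (hasFDerivAt_prodMk_right _ _)
    have h2 : HasFDerivAt (fun q => Ψ (0, q)) (ContinuousLinearMap.id ℝ (BaseSpace V)) j.base :=
      (hasFDerivAt_id _).congr_of_eventuallyEq
        (Filter.eventually_of_mem ((hs.preimage (by fun_prop : Continuous fun q : BaseSpace V =>
          ((0 : Fin m → ℝ), q))).mem_nhds hjs) fun q hq => hΨ0 q hq)
    exact congrArg (fun A : BaseSpace V →L[ℝ] BaseSpace V => A w) (h1.unique h2)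
  have hLd : HasFDerivAt (Ψ ∘ κ) (L : _ →L[ℝ] _) 0 := by
    convert hψd 0 h0 using 1
    refine ContinuousLinearMap.ext fun ⟨t, a, b⟩ => ?_
    have h1 : ∀ i, fderiv ℝ Ψ (0, j.base) (Pi.single i 1, 0) = L (0, Pi.single i 1, 0) :=
        fun i => by
      rw [hΨd _ hjs, hΨ0 _ hjs, (hXZ i).eq_of_nhds]
      exact (hLv i).symm
    let A : (Fin m → ℝ) →L[ℝ] BaseSpace V :=
      fderiv ℝ Ψ (0, j.base) ∘L ContinuousLinearMap.inl ℝ _ _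
    let A' : (Fin m → ℝ) →L[ℝ] BaseSpace V :=
      (L : BaseSpace (SplitSpace m k) →L[ℝ] BaseSpace V) ∘L
        ContinuousLinearMap.inr ℝ _ _ ∘L ContinuousLinearMap.inl ℝ _ _
    have hAA' : (A : (Fin m → ℝ) →ₗ[ℝ] BaseSpace V) = A' :=
      LinearMap.pi_ext' fun i => LinearMap.ext_ring (h1 i)
    have h2 : fderiv ℝ Ψ (0, j.base) (a, 0) = L (0, a, 0) := LinearMap.congr_fun hAA' a
    rw [ContinuousLinearMap.comp_apply, hκ0, hπ,
      show (a, L (t, 0, b)) = (a, 0) + (0, L (t, 0, b)) by simp, map_add, hΨq, h2]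
    change L (t, a, b) = _
    rw [← map_add]
    simp
  obtain ⟨e, h0e, hes, hecoe, -, hesymm⟩ := hψ.exists_openPartialHomeomorph hs₂ h0 L hLd
  have hinv (q) (hq : q ∈ e.target) (w) :
      fderiv ℝ e.symm q (fderiv ℝ (Ψ ∘ κ) (e.symm q) w) = w := by
    have hx := e.map_target hq
    have h1 : HasFDerivAt (e.symm ∘ (Ψ ∘ κ)) _ (e.symm q) :=
      HasFDerivAt.comp (e.symm q) (g := e.symm)
      (((hesymm.contDiffAt (e.open_target.mem_nhds
        (by rwa [← hecoe, e.right_inv hq]))).differentiableAt (by simp)).hasFDerivAt)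
      ((hψ.contDiffAt (hs₂.mem_nhds (hes hx))).differentiableAt (by simp)).hasFDerivAt
    have h2 : HasFDerivAt (e.symm ∘ (Ψ ∘ κ)) (ContinuousLinearMap.id ℝ _) (e.symm q) :=
      (hasFDerivAt_id _).congr_of_eventuallyEq
        (Filter.eventually_of_mem (e.open_source.mem_nhds hx) fun x hx => by
          rw [Function.comp_apply, ← hecoe, e.left_inv hx, id])
    have h3 := congrArg (fun A : _ →L[ℝ] _ => A w) (h1.unique h2)
    rw [← hecoe, e.right_inv hq] at h3
    exact h3
  have hje : j.base ∈ e.target := by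
    rw [← hψ0, ← hecoe]
    exact e.map_source h0e
  have hj0 : e.symm j.base = 0 := by
    rw [← hψ0, ← hecoe, e.left_inv h0e]
  refine ⟨k, e.symm, ⟨fun q hq => ?_, hesymm, ?_, fun q hq i => ?_⟩, hje, ?_⟩
  · have := (hΩ' _ (hes (e.map_target hq)).2).1
    rwa [← hecoe, e.right_inv hq] at this
  · exact (hψ.mono hes).congr fun x _ => hecoe x
  · have h1 := hinv q hq (0, Pi.single i 1, 0)
    rwa [hψi _ (hes (e.map_target hq)), ← hecoe, e.right_inv hq] at h1
  -- The inverse chart has derivative `L` at the origin and `L (1, 0) = (1, ẏ)`, so in fact `dt/dx =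
  -- 1` at `j`.
  · have h1 := hinv _ hje (1, 0)
    have hd : DifferentiableAt ℝ e.symm j.base :=
      (hesymm.contDiffAt (e.open_target.mem_nhds hje)).differentiableAt (by simp)
    rw [hj0, hLd.fderiv] at h1
    have h2 : totalDeriv (fun p => (e.symm p).1) j = (fderiv ℝ e.symm j.base (1, j.2.2)).1 := by
      rw [totalDeriv, hd.hasFDerivAt.fst.fderiv]
      rfl
    rw [h2, ← hLw]
    rw [show L₀ (1, 0) = L (1, 0) from rfl]
    erw [h1]
    simp

end Straightening

/-! ### Total derivatives, prolongations and point transformations -/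

section Jets

variable {V V' F : Type*} [NormedAddCommGroup V] [NormedSpace ℝ V]
  [NormedAddCommGroup V'] [NormedSpace ℝ V'] [NormedAddCommGroup F] [NormedSpace ℝ F]

variable (V) in
/-- The projection `(x, y, ẏ) ↦ (x, y)` as a continuous linear map. -/
noncomputable def baseCLM : JetSpace V →L[ℝ] BaseSpace V :=
  (ContinuousLinearMap.fst ℝ _ _).prod
    (ContinuousLinearMap.fst ℝ _ _ ∘L ContinuousLinearMap.snd ℝ _ _)

lemma continuous_base : Continuous (JetSpace.base : JetSpace V → BaseSpace V) :=
  (baseCLM V).continuous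

lemma hasFDerivAt_comp_base {h : BaseSpace V → F} {j : JetSpace V}
    (hh : DifferentiableAt ℝ h j.base) :
    HasFDerivAt (fun j : JetSpace V => h j.base) (fderiv ℝ h j.base ∘L baseCLM V) j :=
  hh.hasFDerivAt.comp j (baseCLM V).hasFDerivAt

lemma ContDiffAt.comp_base {h : BaseSpace V → F} {j : JetSpace V} (hh : ContDiffAt ℝ ∞ h j.base) :
    ContDiffAt ℝ ∞ (fun j : JetSpace V => h j.base) j :=
  ContDiffAt.comp j (g := h) hh (baseCLM V).contDiff.contDiffAt

lemma ContDiffAt.totalDeriv {h : BaseSpace V → F} {j : JetSpace V}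
    (hh : ContDiffAt ℝ ∞ h j.base) : ContDiffAt ℝ ∞ (totalDeriv h) j :=
  (ContDiffAt.comp_base (hh.fderiv_right (m := ∞) (by simp))).clm_apply (by fun_prop)

lemma fderiv_totalDeriv {h : BaseSpace V → F} {j : JetSpace V}
    (hh : ContDiffAt ℝ ∞ h j.base) (w : JetSpace V) :
    fderiv ℝ (totalDeriv h) j w =
      fderiv ℝ (fderiv ℝ h) j.base w.base (1, j.2.2) + fderiv ℝ h j.base (0, w.2.2) := by
  have h1 := hasFDerivAt_comp_base
    ((hh.fderiv_right (m := ∞) (by simp)).differentiableAt (by simp))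
  have h2 : HasFDerivAt (fun j : JetSpace V => ((1 : ℝ), j.2.2)) _ j :=
    (hasFDerivAt_const (1 : ℝ) j).prodMk
      (ContinuousLinearMap.snd ℝ V V ∘L ContinuousLinearMap.snd ℝ ℝ (V × V)).hasFDerivAt
  have h3 := (h1.clm_apply h2).fderiv
  rw [show fderiv ℝ (totalDeriv h) j = _ from h3, add_comm]
  rfl

/-- The commutator of the prolongation of `X` with the total derivative. -/
lemma fderiv_totalDeriv_prolongation {h : BaseSpace V → F} {X : BaseSpace V → BaseSpace V}
    {j : JetSpace V} (hh : ContDiffAt ℝ ∞ h j.base) (hX : DifferentiableAt ℝ X j.base) :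
    fderiv ℝ (totalDeriv h) j (prolongation X j) =
      totalDeriv (fun p => fderiv ℝ h p (X p)) j - (totalDeriv X j).1 • totalDeriv h j := by
  have hsymm := (hh.isSymmSndFDerivAt (by
    simpa using (by exact_mod_cast le_top : ((2 : ℕ∞) : WithTop ℕ∞) ≤ ∞))).eq (X j.base) (1, j.2.2)
  have h1 : HasFDerivAt (fun p => fderiv ℝ h p (X p)) _ j.base :=
    ((hh.fderiv_right (m := ∞) (by simp)).differentiableAt (by simp)).hasFDerivAt.clm_apply
      hX.hasFDerivAt
  rw [fderiv_totalDeriv hh, totalDeriv, h1.fderiv]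
  simp only [prolongation, totalDeriv, hX.hasFDerivAt.fst.fderiv, hX.hasFDerivAt.snd.fderiv]
  change fderiv ℝ (fderiv ℝ h) j.base (X j.base) (1, j.2.2) + fderiv ℝ h j.base (0, _) =
    fderiv ℝ h j.base (fderiv ℝ X j.base (1, j.2.2)) +
      fderiv ℝ (fderiv ℝ h) j.base (1, j.2.2) (X j.base) - _
  rw [hsymm, add_comm (fderiv ℝ h j.base _), add_sub_assoc, ← map_smul, ← map_sub]
  congr 2
  ext <;> simp

lemma prolongation_eq {Z : BaseSpace V → BaseSpace V} {j : JetSpace V}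
    (hZ : DifferentiableAt ℝ Z j.base) :
    prolongation Z j =
      ((Z j.base).1, (Z j.base).2, (totalDeriv Z j).2 - (totalDeriv Z j).1 • j.2.2) := by
  simp only [prolongation, totalDeriv, hZ.hasFDerivAt.fst.fderiv, hZ.hasFDerivAt.snd.fderiv]
  rfl

lemma ContDiffAt.eventually_differentiableAt {E : Type*} [NormedAddCommGroup E] [NormedSpace ℝ E]
    {h : E → F} {p : E} (hh : ContDiffAt ℝ ∞ h p) : ∀ᶠ q in nhds p, DifferentiableAt ℝ h q := by
  filter_upwards [(hh.of_le (m := 1) (by simp)).eventually (by simp)] with q hq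
  exact hq.differentiableAt (by simp)

lemma ContDiffAt.prolongation {Z : BaseSpace V → BaseSpace V} {j : JetSpace V}
    (hZ : ContDiffAt ℝ ∞ Z j.base) : ContDiffAt ℝ ∞ (prolongation Z) j :=
  hZ.fst.comp_base.prodMk (hZ.snd.comp_base.prodMk
    (hZ.snd.totalDeriv.sub (hZ.fst.totalDeriv.smul (by fun_prop))))

lemma fderiv_prolongation {X Z : BaseSpace V → BaseSpace V} {j : JetSpace V}
    (hX : ContDiffAt ℝ ∞ X j.base) (hZ : ContDiffAt ℝ ∞ Z j.base) :
    fderiv ℝ (prolongation Z) j (prolongation X j) =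
      ((fderiv ℝ Z j.base (X j.base)).1, (fderiv ℝ Z j.base (X j.base)).2,
        (totalDeriv (fun p => fderiv ℝ Z p (X p)) j - (totalDeriv X j).1 • totalDeriv Z j).2 -
        ((totalDeriv (fun p => fderiv ℝ Z p (X p)) j - (totalDeriv X j).1 • totalDeriv Z j).1 •
            j.2.2 +
          (totalDeriv Z j).1 • ((totalDeriv X j).2 - (totalDeriv X j).1 • j.2.2))) := by
  have hXd := hX.differentiableAt (by simp)
  have hZd := hZ.differentiableAt (by simp)
  have hev : prolongation Z =ᶠ[nhds j] fun j =>
      ((Z j.base).1, (Z j.base).2, (totalDeriv Z j).2 - (totalDeriv Z j).1 • j.2.2) := by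
    filter_upwards [continuous_base.continuousAt.eventually hZ.eventually_differentiableAt]
      with i hi using prolongation_eq hi
  have h1 := hasFDerivAt_comp_base hZd
  have h2 := (hZ.totalDeriv.differentiableAt (by simp)).hasFDerivAt
  have h3 : HasFDerivAt (fun j : JetSpace V => j.2.2) _ j :=
    (ContinuousLinearMap.snd ℝ V V ∘L ContinuousLinearMap.snd ℝ ℝ (V × V)).hasFDerivAt
  have h4 := h1.fst.prodMk (h1.snd.prodMk (h2.snd.sub (h2.fst.smul h3)))
  rw [hev.fderiv_eq, ← fderiv_totalDeriv_prolongation hZ hXd]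
  refine (congrArg (fun A : _ →L[ℝ] _ => A (prolongation X j)) h4.fderiv).trans ?_
  have h5 : (prolongation X j).2.2 = (totalDeriv X j).2 - (totalDeriv X j).1 • j.2.2 := by
    rw [prolongation_eq hXd]
  rw [← h5, add_comm (_ • j.2.2)]
  rfl

/-- Prolongation is a homomorphism of Lie algebras. -/
lemma lieBracket_prolongation {X Z : BaseSpace V → BaseSpace V} {j : JetSpace V}
    (hX : ContDiffAt ℝ ∞ X j.base) (hZ : ContDiffAt ℝ ∞ Z j.base) :
    VectorField.lieBracket ℝ (prolongation X) (prolongation Z) j =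
      prolongation (VectorField.lieBracket ℝ X Z) j := by
  have hd {X Z : BaseSpace V → BaseSpace V} (hX : ContDiffAt ℝ ∞ X j.base)
      (hZ : ContDiffAt ℝ ∞ Z j.base) : DifferentiableAt ℝ (fun p => fderiv ℝ Z p (X p)) j.base :=
    ((hZ.fderiv_right (m := ∞) (by simp)).clm_apply hX).differentiableAt (by simp)
  have h1 : totalDeriv (VectorField.lieBracket ℝ X Z) j =
      totalDeriv (fun p => fderiv ℝ Z p (X p)) j - totalDeriv (fun p => fderiv ℝ X p (Z p)) j := by
    have h := ((hd hX hZ).hasFDerivAt.sub (hd hZ hX).hasFDerivAt).fderiv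
    rw [totalDeriv, show fderiv ℝ (VectorField.lieBracket ℝ X Z) j.base = _ from h]
    rfl
  rw [prolongation_eq
      (hX.lieBracket_vectorField hZ (m := ∞) (by simp) |>.differentiableAt (by simp)),
    h1, VectorField.lieBracket, fderiv_prolongation hX hZ, fderiv_prolongation hZ hX]
  refine Prod.ext rfl (Prod.ext rfl ?_)
  -- All products of total derivatives of `X` and `Z` are symmetric in the two fields and cancel.
  simp only [Prod.snd_sub, Prod.fst_sub, Prod.smul_fst, Prod.smul_snd, smul_eq_mul]
  module

/-- The action on `(x, y, ẏ)` of a point transformation `φ` of the variables `(x, y)`. -/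
noncomputable def jetMap (φ : BaseSpace V → BaseSpace V') (j : JetSpace V) : JetSpace V' :=
  ((φ j.base).1, (φ j.base).2, (totalDeriv φ j).1⁻¹ • (totalDeriv φ j).2)

lemma jetMap_base (φ : BaseSpace V → BaseSpace V') (j : JetSpace V) :
    (jetMap φ j).base = φ j.base := rfl

lemma ContDiffAt.jetMap {φ : BaseSpace V → BaseSpace V'} {j : JetSpace V}
    (hφ : ContDiffAt ℝ ∞ φ j.base) (hτ : (_root_.totalDeriv φ j).1 ≠ 0) :
    ContDiffAt ℝ ∞ (jetMap φ) j :=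
  hφ.fst.comp_base.prodMk (hφ.snd.comp_base.prodMk
    ((hφ.totalDeriv.fst.inv hτ).smul hφ.totalDeriv.snd))

lemma fderiv_symm_apply_fderiv {E E' : Type*} [NormedAddCommGroup E] [NormedSpace ℝ E]
    [NormedAddCommGroup E'] [NormedSpace ℝ E'] (e : OpenPartialHomeomorph E E')
    (he : ContDiffOn ℝ ∞ e e.source) (he' : ContDiffOn ℝ ∞ e.symm e.target) {p : E}
    (hp : p ∈ e.source) (w : E) : fderiv ℝ e.symm (e p) (fderiv ℝ e p w) = w := by
  have h1 : HasFDerivAt (e.symm ∘ e) _ p := HasFDerivAt.comp p (g := e.symm)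
    ((he'.contDiffAt (e.open_target.mem_nhds (e.map_source hp))).differentiableAt
      (by simp)).hasFDerivAt
    ((he.contDiffAt (e.open_source.mem_nhds hp)).differentiableAt (by simp)).hasFDerivAt
  have h2 : HasFDerivAt (e.symm ∘ e) (ContinuousLinearMap.id ℝ _) p :=
    (hasFDerivAt_id _).congr_of_eventuallyEq
      (Filter.eventually_of_mem (e.open_source.mem_nhds hp) fun x hx => e.left_inv hx)
  exact congrArg (fun A : _ →L[ℝ] _ => A w) (h1.unique h2)

lemma jetMap_symm_jetMap (e : OpenPartialHomeomorph (BaseSpace V) (BaseSpace V'))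
    (he : ContDiffOn ℝ ∞ e e.source) (he' : ContDiffOn ℝ ∞ e.symm e.target) {j : JetSpace V}
    (hj : j.base ∈ e.source) (hτ : (totalDeriv e j).1 ≠ 0) :
    (totalDeriv e.symm (jetMap e j)).1 ≠ 0 ∧ jetMap e.symm (jetMap e j) = j := by
  -- Chain rule: the transformed direction is `de(1, ẏ)` divided by its first component, so the
  -- inverse derivative returns a multiple of `(1, ẏ)`, and the quotient recovers `ẏ`.
  have h : totalDeriv e.symm (jetMap e j) = (totalDeriv e j).1⁻¹ • (1, j.2.2) := by
    have h1 := fderiv_symm_apply_fderiv e he he' hj ((totalDeriv e j).1⁻¹ • (1, j.2.2))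
    rw [map_smul] at h1
    rw [← h1, totalDeriv]
    congr 1
    refine Prod.ext (inv_mul_cancel₀ hτ).symm rfl
  refine ⟨by simpa [h] using hτ, ?_⟩
  rw [jetMap, h, jetMap_base, e.left_inv hj]
  refine Prod.ext rfl (Prod.ext rfl ?_)
  simp [smul_smul, hτ]

end Jets

/-! ### The reduced variables as invariants of the prolonged generators -/

section ReducedVariables

variable {V V' : Type*} [NormedAddCommGroup V] [NormedSpace ℝ V]
  [NormedAddCommGroup V'] [NormedSpace ℝ V'] {m k : ℕ}

/-- If `φ` carries `X` to a constant field, the total derivative of that field vanishes, and the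
commutator formula leaves only a common rescaling of `dt/dx` and `ds/dx`. Their quotient `ṡ` is
therefore unchanged. -/
lemma fderiv_jetMap_prolongation {φ : BaseSpace V → BaseSpace V'} {X : BaseSpace V → BaseSpace V}
    {j : JetSpace V} (hφ : ContDiffAt ℝ ∞ φ j.base) (hX : DifferentiableAt ℝ X j.base)
    (hτ : (totalDeriv φ j).1 ≠ 0) {c : BaseSpace V'}
    (hc : ∀ᶠ p in nhds j.base, fderiv ℝ φ p (X p) = c) :
    fderiv ℝ (jetMap φ) j (prolongation X j) = (c.1, c.2, 0) := by
  have h0 : totalDeriv (fun p => fderiv ℝ φ p (X p)) j = 0 := by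
    have : (fun p => fderiv ℝ φ p (X p)) =ᶠ[nhds j.base] fun _ => c := hc
    rw [totalDeriv, this.fderiv_eq]
    simp
  have h1 := hasFDerivAt_comp_base (hφ.differentiableAt (by simp))
  have h2 := (hφ.totalDeriv.differentiableAt (by simp)).hasFDerivAt
  have h3 := h1.fst.prodMk (h1.snd.prodMk
    (((hasDerivAt_inv hτ).comp_hasFDerivAt j h2.fst).smul h2.snd))
  have h4 : fderiv ℝ (totalDeriv φ) j (prolongation X j) =
      -((totalDeriv X j).1 • totalDeriv φ j) := by
    rw [fderiv_totalDeriv_prolongation hφ hX, h0, zero_sub]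
  have h5 : fderiv ℝ φ j.base (X j.base) = c := hc.self_of_nhds
  refine (congrArg (fun A : _ →L[ℝ] _ => A (prolongation X j)) h3.fderiv).trans ?_
  have h6 : baseCLM V (prolongation X j) = X j.base := rfl
  refine Prod.ext ?_ (Prod.ext ?_ ?_)
  · simp [h6, h5]
  · simp [h6, h5]
  · simp only [ContinuousLinearMap.prod_apply, add_apply, smul_apply,
      ContinuousLinearMap.comp_apply, ContinuousLinearMap.smulRight_apply, h4,
      ContinuousLinearMap.coe_fst', ContinuousLinearMap.coe_snd', Prod.snd_neg, Prod.fst_neg,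
      Prod.smul_fst, Prod.smul_snd, smul_eq_mul, Function.comp_apply]
    generalize (totalDeriv φ j).1 = τ at *
    rw [smul_neg, smul_smul, neg_add_eq_zero]
    congr 1
    field_simp

variable (m k) in
/-- The projection `(t, s, ṡ) ↦ (t, sᵝ, ṡⁱ, ṡᵝ)`. -/
noncomputable def reducedCLM : JetSpace (SplitSpace m k) →L[ℝ] ReducedSpace m k :=
  (ContinuousLinearMap.fst ℝ _ _).prod
    ((ContinuousLinearMap.snd ℝ _ _ ∘L ContinuousLinearMap.fst ℝ _ _ ∘L
      ContinuousLinearMap.snd ℝ _ _).prod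
      (ContinuousLinearMap.snd ℝ _ _ ∘L ContinuousLinearMap.snd ℝ _ _))

lemma reducedCLM_apply (q : JetSpace (SplitSpace m k)) :
    reducedCLM m k q = (q.1, q.2.1.2, q.2.2.1, q.2.2.2) := rfl

variable {φ : BaseSpace V → BaseSpace (SplitSpace m k)} {j : JetSpace V}

lemma totalDeriv_fst (hφ : DifferentiableAt ℝ φ j.base) :
    totalDeriv (fun p => (φ p).1) j = (totalDeriv φ j).1 := by
  rw [totalDeriv, hφ.hasFDerivAt.fst.fderiv]
  rfl

lemma reducedCoords_eq (hφ : DifferentiableAt ℝ φ j.base) :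
    reducedCoords φ j = reducedCLM m k (jetMap φ j) := by
  have h : totalDeriv (fun p => (φ p).2) j = (totalDeriv φ j).2 := by
    rw [totalDeriv, hφ.hasFDerivAt.snd.fderiv]
    rfl
  rw [reducedCoords, newVelocity, totalDeriv_fst hφ, h]
  rfl

lemma reducedCoords_eventuallyEq (hφ : ContDiffAt ℝ ∞ φ j.base) :
    reducedCoords φ =ᶠ[nhds j] fun j => reducedCLM m k (jetMap φ j) := by
  filter_upwards [continuous_base.continuousAt.eventually hφ.eventually_differentiableAt]
    with i hi using reducedCoords_eq hi

lemma ContDiffAt.reducedCoords (hφ : ContDiffAt ℝ ∞ φ j.base) (hτ : (_root_.totalDeriv φ j).1 ≠ 0) :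
    ContDiffAt ℝ ∞ (reducedCoords φ) j :=
  ((reducedCLM m k).contDiff.contDiffAt.comp j (hφ.jetMap hτ)).congr_of_eventuallyEq
    (reducedCoords_eventuallyEq hφ)

lemma fderiv_reducedCoords (hφ : ContDiffAt ℝ ∞ φ j.base) (hτ : (totalDeriv φ j).1 ≠ 0)
    (w : JetSpace V) :
    fderiv ℝ (reducedCoords φ) j w = reducedCLM m k (fderiv ℝ (jetMap φ) j w) := by
  rw [(reducedCoords_eventuallyEq hφ).fderiv_eq]
  exact congrArg (fun A : _ →L[ℝ] _ => A w) ((reducedCLM m k).hasFDerivAt.comp j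
    ((hφ.jetMap hτ).differentiableAt (by simp)).hasFDerivAt).fderiv

/-- Each function of `(x, y, ẏ)` which is invariant under the prolonged generators is, locally, a
function of the reduced variables. -/
theorem exists_crossSection {Ω : Set (BaseSpace V)} {Z : Fin m → BaseSpace V → BaseSpace V}
    (hZ : ∀ i, ∀ p ∈ Ω, DifferentiableAt ℝ (Z i) p)
    {φ : OpenPartialHomeomorph (BaseSpace V) (BaseSpace (SplitSpace m k))}
    (hφ : IsNormalFormChart Ω Z φ) {U : Set (JetSpace V)} (hU : IsOpen U) {j₀ : JetSpace V}
    (hj₀ : j₀ ∈ U) (hj₀φ : j₀.base ∈ φ.source) (hτ₀ : (totalDeriv φ j₀).1 ≠ 0) :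
    ∃ (O : Set (JetSpace V)) (W : Set (ReducedSpace m k)) (κ : ReducedSpace m k → JetSpace V)
      (σ : BaseSpace (Fin k → ℝ) → BaseSpace V),
      j₀ ∈ O ∧ IsOpen O ∧ O ⊆ U ∧ (∀ j ∈ O, j.base ∈ φ.source) ∧
      (∀ j ∈ O, (totalDeriv φ j).1 ≠ 0) ∧ IsOpen W ∧ reducedCoords φ '' O = W ∧
      ContDiffOn ℝ ∞ κ W ∧ Set.MapsTo κ W O ∧ (∀ r ∈ W, reducedCoords φ (κ r) = r) ∧
      (∀ r ∈ W, (κ r).base = σ (r.1, r.2.1)) ∧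
      ∀ H : JetSpace V → ReducedSpace m k, DifferentiableOn ℝ H O →
        (∀ j ∈ O, ∀ i, fderiv ℝ H j (prolongation (Z i) j) = 0) →
        ∀ j ∈ O, H j = H (κ (reducedCoords φ j)) := by
  have hφa {p} (hp : p ∈ φ.source) : ContDiffAt ℝ ∞ φ p :=
    hφ.contDiffOn.contDiffAt (φ.open_source.mem_nhds hp)
  have hφa' {p} (hp : p ∈ φ.target) : ContDiffAt ℝ ∞ φ.symm p :=
    hφ.contDiffOn_symm.contDiffAt (φ.open_target.mem_nhds hp)
  let D : Set (JetSpace V) := {j | j.base ∈ φ.source ∧ (totalDeriv φ j).1 ≠ 0}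
  let D' : Set (JetSpace (SplitSpace m k)) :=
    {q | q.base ∈ φ.target ∧ (totalDeriv φ.symm q).1 ≠ 0}
  have hD : IsOpen D :=
    ContinuousOn.isOpen_inter_preimage (f := totalDeriv φ) (s := JetSpace.base ⁻¹' φ.source)
      (t := {v | v.1 ≠ 0}) (fun j hj => (hφa hj).totalDeriv.continuousAt.continuousWithinAt)
      (φ.open_source.preimage continuous_base) (isOpen_ne.preimage continuous_fst)
  have hD' : IsOpen D' :=
    ContinuousOn.isOpen_inter_preimage (f := totalDeriv φ.symm) (s := JetSpace.base ⁻¹' φ.target)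
      (t := {v | v.1 ≠ 0}) (fun j hj => (hφa' hj).totalDeriv.continuousAt.continuousWithinAt)
      (φ.open_target.preimage continuous_base) (isOpen_ne.preimage continuous_fst)
  have hJ : ∀ j ∈ D, ContDiffAt ℝ ∞ (jetMap φ) j := fun j hj => (hφa hj.1).jetMap hj.2
  have hK : ∀ q ∈ D', ContDiffAt ℝ ∞ (jetMap φ.symm) q := fun q hq => (hφa' hq.1).jetMap hq.2
  have hKJ : ∀ j ∈ D, jetMap φ j ∈ D' ∧ jetMap φ.symm (jetMap φ j) = j := fun j hj =>
    have h := jetMap_symm_jetMap φ hφ.contDiffOn hφ.contDiffOn_symm hj.1 hj.2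
    ⟨⟨φ.map_source hj.1, h.1⟩, h.2⟩
  have hJK : ∀ q ∈ D', jetMap φ.symm q ∈ D ∧ jetMap φ (jetMap φ.symm q) = q := fun q hq =>
    have h := jetMap_symm_jetMap φ.symm hφ.contDiffOn_symm hφ.contDiffOn hq.1 hq.2
    ⟨⟨φ.map_target hq.1, h.1⟩, h.2⟩
  have hj₀D : j₀ ∈ D := ⟨hj₀φ, hτ₀⟩
  have hG : IsOpen (D' ∩ jetMap φ.symm ⁻¹' U) :=
    ContinuousOn.isOpen_inter_preimage (fun q hq => (hK q hq).continuousAt.continuousWithinAt)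
      hD' hU
  set q₀ := jetMap φ j₀ with hq₀
  obtain ⟨ε, hε, hball⟩ := Metric.isOpen_iff.1 hG q₀
    ⟨(hKJ _ hj₀D).1, by rwa [Set.mem_preimage, (hKJ _ hj₀D).2]⟩
  -- A ball of the sup metric: it is convex, and resetting the coordinates `sⁱ` to those of the
  -- centre does not leave it.
  let B := Metric.ball q₀ ε
  let O : Set (JetSpace V) := D ∩ jetMap φ ⁻¹' B
  -- The cross-section freezes `sⁱ` at their values at `j₀`.
  let ι : ReducedSpace m k → JetSpace (SplitSpace m k) := fun r =>
    (r.1, (q₀.2.1.1, r.2.1), (r.2.2.1, r.2.2.2))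
  have hι : ContDiff ℝ ∞ ι := by fun_prop
  have hO : IsOpen O := ContinuousOn.isOpen_inter_preimage
    (fun j hj => (hJ j hj).continuousAt.continuousWithinAt) hD Metric.isOpen_ball
  have hιB : ∀ q ∈ B, ι (reducedCLM m k q) ∈ B := fun q hq => by
    refine lt_of_le_of_lt ?_ (Metric.mem_ball.1 hq)
    simp only [Prod.dist_eq, ι, reducedCLM_apply, dist_self]
    gcongr
    exact dist_nonneg
  have hρι (r) : reducedCLM m k (ι r) = r := rfl
  have hBO : ∀ q ∈ B, jetMap φ.symm q ∈ O ∧ jetMap φ (jetMap φ.symm q) = q := fun q hq => by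
    have h := hJK q (hball hq).1
    exact ⟨⟨h.1, by rwa [Set.mem_preimage, h.2]⟩, h.2⟩
  have hR : ∀ j ∈ D, reducedCoords φ j = reducedCLM m k (jetMap φ j) := fun j hj =>
    reducedCoords_eq ((hφa hj.1).differentiableAt (by simp))
  have hRκ : ∀ r ∈ ι ⁻¹' B, reducedCoords φ (jetMap φ.symm (ι r)) = r := fun r hr => by
    rw [hR _ (hBO _ hr).1.1, (hBO _ hr).2, hρι]
  refine ⟨O, ι ⁻¹' B, fun r => jetMap φ.symm (ι r),
    fun b => φ.symm (b.1, q₀.2.1.1, b.2), ⟨hj₀D, Metric.mem_ball_self hε⟩, hO, fun j hj => ?_,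
    fun j hj => hj.1.1, fun j hj => hj.1.2, Metric.isOpen_ball.preimage hι.continuous, ?_,
    fun r hr => ((hK _ (hball hr).1).comp r hι.contDiffAt).contDiffWithinAt,
    fun r hr => (hBO _ hr).1, hRκ, fun r hr => rfl, fun H hH hinv j hj => ?_⟩
  · have := (hball hj.2).2
    rwa [Set.mem_preimage, (hKJ j hj.1).2] at this
  · refine Set.Subset.antisymm ?_ fun r hr => ⟨_, (hBO _ hr).1, hRκ r hr⟩
    rintro _ ⟨j, hj, rfl⟩
    rw [hR j hj.1]
    exact hιB _ hj.2
  · rw [hR j hj.1]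
    have hHd {i} (hi : i ∈ O) : DifferentiableAt ℝ H i :=
      (hH i hi).differentiableAt (hO.mem_nhds hi)
    have hKd {q} (hq : q ∈ B) : DifferentiableAt ℝ (jetMap φ.symm) q :=
      (hK q (hball hq).1).differentiableAt (by simp)
    have hKi : ∀ q ∈ B, ∀ i, fderiv ℝ (jetMap φ.symm) q (0, (Pi.single i 1, 0), 0) =
        prolongation (Z i) (jetMap φ.symm q) := fun q hq i => by
      obtain ⟨hqO, hqe⟩ := hBO q hq
      have h1 : fderiv ℝ (jetMap φ) (jetMap φ.symm q) (prolongation (Z i) (jetMap φ.symm q)) =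
          (0, (Pi.single i 1, 0), 0) :=
        fderiv_jetMap_prolongation (hφa hqO.1.1) (hZ i _ (hφ.source_subset hqO.1.1)) hqO.1.2
          (Filter.eventually_of_mem (φ.open_source.mem_nhds hqO.1.1)
            fun p hp => hφ.normal_form p hp i)
      have h2 : HasFDerivAt (jetMap φ.symm ∘ jetMap φ) _ (jetMap φ.symm q) :=
        HasFDerivAt.comp _ (by rw [hqe]; exact (hKd hq).hasFDerivAt)
          ((hJ _ hqO.1).differentiableAt (by simp)).hasFDerivAt
      have h3 : HasFDerivAt (jetMap φ.symm ∘ jetMap φ) (ContinuousLinearMap.id ℝ _)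
          (jetMap φ.symm q) :=
        (hasFDerivAt_id _).congr_of_eventuallyEq
          (Filter.eventually_of_mem (hD.mem_nhds hqO.1) fun i hi => (hKJ i hi).2)
      have h4 := congrArg (fun A : JetSpace V →L[ℝ] JetSpace V =>
        A (prolongation (Z i) (jetMap φ.symm q))) (h2.unique h3)
      rw [ContinuousLinearMap.comp_apply, h1] at h4
      exact h4
    have hHK : ∀ q ∈ B, ∀ a : Fin m → ℝ,
        fderiv ℝ (H ∘ jetMap φ.symm) q (0, (a, 0), 0) = 0 := fun q hq a => by
      let A : (Fin m → ℝ) →L[ℝ] ReducedSpace m k :=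
        fderiv ℝ (H ∘ jetMap φ.symm) q ∘L ContinuousLinearMap.inr ℝ _ _ ∘L
          ContinuousLinearMap.inl ℝ _ _ ∘L ContinuousLinearMap.inl ℝ _ _
      have hA : (A : (Fin m → ℝ) →ₗ[ℝ] ReducedSpace m k) = 0 :=
        LinearMap.pi_ext' fun i => LinearMap.ext_ring (by
          change fderiv ℝ (H ∘ jetMap φ.symm) q (0, (Pi.single i 1, 0), 0) = 0
          rw [((hHd (hBO q hq).1).hasFDerivAt.comp q (hKd hq).hasFDerivAt).fderiv,
            ContinuousLinearMap.comp_apply, hKi q hq, hinv _ (hBO q hq).1])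
      exact LinearMap.congr_fun hA a
    -- The segment from `q₁` to its projection `q₂` on the cross-section stays in `B` and runs in
    -- the `sⁱ` directions only, along which an invariant is constant.
    let q₁ := jetMap φ j
    let q₂ := ι (reducedCLM m k q₁)
    have hq₁ : q₁ ∈ B := hj.2
    have hq₂ : q₂ ∈ B := hιB _ hq₁
    have hline (θ : ℝ) : HasDerivAt (fun θ : ℝ => q₁ + θ • (q₂ - q₁)) (q₂ - q₁) θ := by
      simpa using ((hasDerivAt_id θ).smul_const (q₂ - q₁)).const_add q₁
    have hmem : ∀ θ ∈ Set.Icc (0 : ℝ) 1, q₁ + θ • (q₂ - q₁) ∈ B := fun θ hθ =>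
      (convex_ball q₀ ε).add_smul_sub_mem hq₁ hq₂ hθ
    have hdir : q₂ - q₁ = (0, (q₀.2.1.1 - q₁.2.1.1, 0), 0) := by
      simp only [q₂, ι, reducedCLM_apply]
      refine Prod.ext (sub_self _) (Prod.ext (Prod.ext rfl (sub_self _)) (sub_self _))
    have hder : ∀ θ ∈ Set.Icc (0 : ℝ) 1,
        HasDerivAt (fun θ : ℝ => H (jetMap φ.symm (q₁ + θ • (q₂ - q₁)))) 0 θ := fun θ hθ => by
      have hq := hmem θ hθ
      have h : HasDerivAt (fun θ : ℝ => H (jetMap φ.symm (q₁ + θ • (q₂ - q₁)))) _ θ :=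
        HasFDerivAt.comp_hasDerivAt θ (l := H ∘ jetMap φ.symm)
          ((hHd (hBO _ hq).1).comp _ (hKd hq)).hasFDerivAt (hline θ)
      have h0 : fderiv ℝ (H ∘ jetMap φ.symm) (q₁ + θ • (q₂ - q₁)) (q₂ - q₁) = 0 := by
        nth_rewrite 2 [hdir]
        exact hHK _ hq _
      rwa [h0] at h
    have hconst := constant_of_has_deriv_right_zero
      (fun θ hθ => (hder θ hθ).continuousAt.continuousWithinAt)
      (fun θ hθ => (hder θ ⟨hθ.1, hθ.2.le⟩).hasDerivWithinAt) 1 ⟨zero_le_one, le_rfl⟩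
    simp only [one_smul, add_sub_cancel, zero_smul, add_zero] at hconst
    rw [hconst, (hKJ j hj.1).2]

end ReducedVariables

/-! ### The reduced system and the inherited symmetries -/

section Reduction

lemma two_le_infty : minSmoothness ℝ 2 ≤ (∞ : WithTop ℕ∞) := by
  simpa using (by exact_mod_cast le_top : ((2 : ℕ∞) : WithTop ℕ∞) ≤ ∞)

/-- Carries the symmetry condition down to the reduced space. The map to the reduced variables
forgets the `sⁱ`, so fields can only be related by it, not pushed forward by a diffeomorphism. -/
lemma lieBracket_of_related {E F : Type*} [NormedAddCommGroup E] [NormedSpace ℝ E]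
    [NormedAddCommGroup F] [NormedSpace ℝ F] {R : E → F} {X X' : E → E} {Y Y' : F → F} {p : E}
    (hR : ContDiffAt ℝ ∞ R p) (hX : DifferentiableAt ℝ X p) (hX' : DifferentiableAt ℝ X' p)
    (hY : DifferentiableAt ℝ Y (R p)) (hY' : DifferentiableAt ℝ Y' (R p))
    (h : (fun q => fderiv ℝ R q (X q)) =ᶠ[nhds p] fun q => Y (R q))
    (h' : (fun q => fderiv ℝ R q (X' q)) =ᶠ[nhds p] fun q => Y' (R q)) :
    fderiv ℝ R p (VectorField.lieBracket ℝ X X' p) = VectorField.lieBracket ℝ Y Y' (R p) := by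
  have hRd := (hR.differentiableAt (by simp)).hasFDerivAt
  have h1 : HasFDerivAt (fun q => Y (R q)) _ p := hY.hasFDerivAt.comp p hRd
  have h2 : HasFDerivAt (fun q => Y' (R q)) _ p := hY'.hasFDerivAt.comp p hRd
  rw [VectorField.fderiv_apply_lieBracket hR two_le_infty hX' hX, h.fderiv_eq, h'.fderiv_eq,
    h1.fderiv, h2.fderiv, ContinuousLinearMap.comp_apply, ContinuousLinearMap.comp_apply,
    VectorField.lieBracket, ← h.eq_of_nhds, ← h'.eq_of_nhds]

variable {V V' : Type*} [NormedAddCommGroup V] [NormedSpace ℝ V]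
  [NormedAddCommGroup V'] [NormedSpace ℝ V'] {m k : ℕ}

lemma base_fderiv_jetMap {φ : BaseSpace V → BaseSpace V'} {j : JetSpace V}
    (hφ : ContDiffAt ℝ ∞ φ j.base) (hτ : (totalDeriv φ j).1 ≠ 0) (w : JetSpace V) :
    (fderiv ℝ (jetMap φ) j w).base = fderiv ℝ φ j.base w.base := by
  have h1 := (baseCLM V').hasFDerivAt.comp j
    ((hφ.jetMap hτ).differentiableAt (by simp)).hasFDerivAt
  have h2 := hasFDerivAt_comp_base (hφ.differentiableAt (by simp))
  exact congrArg (fun A : JetSpace V →L[ℝ] BaseSpace V' => A w) (h1.unique h2)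

/-- Changing the independent variable multiplies `A` by `dx/dt`. The Leibniz rule keeps the bracket
parallel to the rescaled operator; the factor is recovered later from `t`-components. -/
lemma IsPointSymmetry.lieBracket_smul {f : JetSpace V → V} {U : Set (JetSpace V)}
    {X : BaseSpace V → BaseSpace V} (hX : IsPointSymmetry f U X) {j : JetSpace V} (hj : j ∈ U)
    (hf : DifferentiableAt ℝ (systemField f) j) {g : JetSpace V → ℝ} (hg : DifferentiableAt ℝ g j)
    (hg0 : g j ≠ 0) :
    ∃ μ : ℝ, VectorField.lieBracket ℝ (prolongation X) (fun i => g i • systemField f i) j =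
      μ • g j • systemField f j := by
  refine ⟨(g j)⁻¹ * fderiv ℝ g j (prolongation X j) -
    fderiv ℝ (fun q => (prolongation X q).1) j (systemField f j), ?_⟩
  have h := VectorField.lieBracket_smul_right (V := prolongation X) hg hf
  change VectorField.lieBracket ℝ (prolongation X) (fun i => g i • systemField f i) j = _ at h
  rw [h, hX j hj, sub_smul, smul_smul, smul_smul, smul_smul, sub_eq_add_neg, ← neg_smul]
  congr 2
  · field_simp
  · ring

theorem exists_isReduction {Ω : Set (BaseSpace V)} (hΩ : IsOpen Ω)
    {U : Set (JetSpace V)} (hU : IsOpen U) {f : JetSpace V → V} (hf : ContDiffOn ℝ ∞ f U)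
    {Z : Fin m → BaseSpace V → BaseSpace V} (hZ : ∀ i, ContDiffOn ℝ ∞ (Z i) Ω)
    (hZs : ∀ i, IsPointSymmetry f U (Z i))
    {φ : OpenPartialHomeomorph (BaseSpace V) (BaseSpace (SplitSpace m k))}
    (hφ : IsNormalFormChart Ω Z φ) {j₀ : JetSpace V}
    (hj₀ : j₀ ∈ U) (hj₀φ : j₀.base ∈ φ.source) (hτ₀ : totalDeriv (fun p => (φ p).1) j₀ ≠ 0) :
    ∃ (O : Set (JetSpace V)) (W : Set (ReducedSpace m k)) (f' : ReducedSpace m k → SplitSpace m k),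
      j₀ ∈ O ∧ IsReduction f U φ O W f' ∧
      ∀ X : BaseSpace V → BaseSpace V, ContDiffOn ℝ ∞ X Ω → IsPointSymmetry f U X →
        (∀ i, ∃ c : Fin m → ℝ, ∀ p ∈ φ.source,
          fderiv ℝ φ p (VectorField.lieBracket ℝ (Z i) X p) = (0, c, 0)) →
        ∃ Y : ReducedSpace m k → ReducedSpace m k, IsReducedGenerator X φ O W Y ∧
          SatisfiesSymmetryCondition (reducedSystemField f') Y W := by
  have hφa {p} (hp : p ∈ φ.source) : ContDiffAt ℝ ∞ φ p :=
    hφ.contDiffOn.contDiffAt (φ.open_source.mem_nhds hp)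
  have hΩa {X : BaseSpace V → BaseSpace V} (hX : ContDiffOn ℝ ∞ X Ω) {p} (hp : p ∈ φ.source) :
      ContDiffAt ℝ ∞ X p := hX.contDiffAt (hΩ.mem_nhds (hφ.source_subset hp))
  have hτeq {j : JetSpace V} (hj : j.base ∈ φ.source) :
      totalDeriv (fun p => (φ p).1) j = (totalDeriv φ j).1 :=
    totalDeriv_fst ((hφa hj).differentiableAt (by simp))
  obtain ⟨O, W, κ, σ, hj₀O, hO, hOU, hOφ, hOτ, hW, hRO, hκ, hκO, hRκ, hκσ, hdesc⟩ :=
    exists_crossSection (fun i p hp => ((hZ i).contDiffAt (hΩ.mem_nhds hp)).differentiableAt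
      (by simp)) hφ hU hj₀ hj₀φ (by rwa [← hτeq hj₀φ])
  let g : JetSpace V → ℝ := fun j => (totalDeriv φ j).1⁻¹
  have hg {j} (hj : j ∈ O) : ContDiffAt ℝ ∞ g j := (hφa (hOφ j hj)).totalDeriv.fst.inv (hOτ j hj)
  have hA {j} (hj : j ∈ O) : ContDiffAt ℝ ∞ (systemField f) j :=
    contDiffAt_const.prodMk (contDiffAt_snd.snd.prodMk (hf.contDiffAt (hU.mem_nhds (hOU hj))))
  let A' : JetSpace V → JetSpace V := fun j => g j • systemField f j
  have hA' {j} (hj : j ∈ O) : ContDiffAt ℝ ∞ A' j := (hg hj).smul (hA hj)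
  have hR {j} (hj : j ∈ O) : ContDiffAt ℝ ∞ (reducedCoords φ) j :=
    (hφa (hOφ j hj)).reducedCoords (hOτ j hj)
  have hRfd {j} (hj : j ∈ O) (w) := fderiv_reducedCoords (hφa (hOφ j hj)) (hOτ j hj) w
  have hsmooth {X : JetSpace V → JetSpace V} {j} (hj : j ∈ O) (hX : ContDiffAt ℝ ∞ X j) :
      ContDiffAt ℝ ∞ (fun j => fderiv ℝ (reducedCoords φ) j (X j)) j :=
    ((hR hj).fderiv_right (m := ∞) (by simp)).clm_apply hX
  -- the reduced system
  let B : JetSpace V → ReducedSpace m k := fun j => fderiv ℝ (reducedCoords φ) j (A' j)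
  have hB {j} (hj : j ∈ O) : ContDiffAt ℝ ∞ B j := hsmooth hj (hA' hj)
  have hBbase {j} (hj : j ∈ O) : (B j).1 = 1 ∧ (B j).2.1 = (reducedCoords φ j).2.2.2 := by
    have h1 := base_fderiv_jetMap (hφa (hOφ j hj)) (hOτ j hj) (A' j)
    have h2 : fderiv ℝ φ j.base (A' j).base = g j • totalDeriv φ j :=
      (fderiv ℝ φ j.base).map_smul (g j) (1, j.2.2)
    have h3 : (B j).1 = (fderiv ℝ (jetMap φ) j (A' j)).base.1 := by
      simp only [B, hRfd hj]; rfl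
    have h4 : (B j).2.1 = (fderiv ℝ (jetMap φ) j (A' j)).base.2.2 := by
      simp only [B, hRfd hj]; rfl
    rw [h3, h4, h1, h2, reducedCoords_eq ((hφa (hOφ j hj)).differentiableAt (by simp))]
    exact ⟨inv_mul_cancel₀ (hOτ j hj), rfl⟩
  have hinv₁ {j} (hj : j ∈ O) (c : Fin m → ℝ) (X : BaseSpace V → BaseSpace V)
      (hX : DifferentiableAt ℝ X j.base) (hc : ∀ p ∈ φ.source, fderiv ℝ φ p (X p) = (0, c, 0)) :
      fderiv ℝ (reducedCoords φ) j (prolongation X j) = 0 := by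
    rw [hRfd hj, fderiv_jetMap_prolongation (hφa (hOφ j hj)) hX (hOτ j hj)
      (Filter.eventually_of_mem (φ.open_source.mem_nhds (hOφ j hj)) hc)]
    rfl
  have hZ0 (i) {j} (hj : j ∈ O) : fderiv ℝ (reducedCoords φ) j (prolongation (Z i) j) = 0 :=
    hinv₁ hj _ (Z i) ((hΩa (hZ i) (hOφ j hj)).differentiableAt (by simp))
      fun p hp => hφ.normal_form p hp i
  -- As `dR(Z i⁽¹⁾) = 0`, differentiating `dR(X)` along `Z i⁽¹⁾` leaves only `dR([Z i⁽¹⁾, X])`.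
  have hbracket (i) {X : JetSpace V → JetSpace V} {j} (hj : j ∈ O) (hX : ContDiffAt ℝ ∞ X j) :
      fderiv ℝ (fun j => fderiv ℝ (reducedCoords φ) j (X j)) j (prolongation (Z i) j) =
        fderiv ℝ (reducedCoords φ) j (VectorField.lieBracket ℝ (prolongation (Z i)) X j) := by
    have h0 : (fun j => fderiv ℝ (reducedCoords φ) j (prolongation (Z i) j)) =ᶠ[nhds j]
        fun _ => 0 := Filter.eventually_of_mem (hO.mem_nhds hj) fun j hj => hZ0 i hj
    rw [VectorField.fderiv_apply_lieBracket (hR hj) two_le_infty (hX.differentiableAt (by simp))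
      ((hΩa (hZ i) (hOφ j hj)).prolongation.differentiableAt (by simp)), h0.fderiv_eq]
    simp
  have hsym {X : BaseSpace V → BaseSpace V} (hX : IsPointSymmetry f U X) {j} (hj : j ∈ O) :
      ∃ μ : ℝ, VectorField.lieBracket ℝ (prolongation X) A' j = μ • A' j :=
    hX.lieBracket_smul (hOU hj) ((hA hj).differentiableAt (by simp))
      ((hg hj).differentiableAt (by simp)) (inv_ne_zero (hOτ j hj))
  have hBinv : ∀ j ∈ O, B j = B (κ (reducedCoords φ j)) := by
    refine hdesc B (fun j hj => ((hB hj).differentiableAt (by simp)).differentiableWithinAt)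
      fun j hj i => ?_
    obtain ⟨μ, hμ⟩ := hsym (hZs i) hj
    have h1 : fderiv ℝ B j (prolongation (Z i) j) = μ • B j := by
      rw [hbracket i hj (hA' hj), hμ, map_smul]
    have h2 : (fun j => (B j).1) =ᶠ[nhds j] fun _ => 1 :=
      Filter.eventually_of_mem (hO.mem_nhds hj) fun j hj => (hBbase hj).1
    have h3 : (fderiv ℝ B j (prolongation (Z i) j)).1 = 0 := by
      have h := ((hB hj).differentiableAt (by simp)).hasFDerivAt.fst.fderiv
      rw [h2.fderiv_eq] at h
      simpa using (congrArg (fun A : _ →L[ℝ] ℝ => A (prolongation (Z i) j)) h).symm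
    have h4 : μ = 0 := by
      rw [h1, Prod.smul_fst, (hBbase hj).1] at h3
      simpa using h3
    rw [h1, h4, zero_smul]
  let f' : ReducedSpace m k → SplitSpace m k := fun r => (B (κ r)).2.2
  have hf' : ContDiffOn ℝ ∞ f' W := fun r hr =>
    ((hB (hκO hr)).snd.snd.comp_contDiffWithinAt r (hκ r hr))
  have hBf' : ∀ j ∈ O, B j = reducedSystemField f' (reducedCoords φ j) := fun j hj =>
    Prod.ext (hBbase hj).1 (Prod.ext (hBbase hj).2 (congrArg (fun b => b.2.2) (hBinv j hj)))
  refine ⟨O, W, f', hj₀O, ⟨hO, hOU, hOφ, fun j hj => ?_, hW, hRO, hf', fun j hj => ?_⟩,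
    fun X hX hXs hXZ => ?_⟩
  · rw [hτeq (hOφ j hj)]
    exact hOτ j hj
  · rw [hτeq (hOφ j hj), ← hBf' j hj, ← map_smul]
  -- the inherited symmetry
  let C : JetSpace V → ReducedSpace m k := fun j =>
    fderiv ℝ (reducedCoords φ) j (prolongation X j)
  have hXa {j} (hj : j ∈ O) : ContDiffAt ℝ ∞ X j.base := hΩa hX (hOφ j hj)
  have hC {j} (hj : j ∈ O) : ContDiffAt ℝ ∞ C j := hsmooth hj (hXa hj).prolongation
  have hCinv : ∀ j ∈ O, C j = C (κ (reducedCoords φ j)) := by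
    refine hdesc C (fun j hj => ((hC hj).differentiableAt (by simp)).differentiableWithinAt)
      fun j hj i => ?_
    obtain ⟨c, hc⟩ := hXZ i
    have hZa := hΩa (hZ i) (hOφ j hj)
    rw [hbracket i hj (hXa hj).prolongation, lieBracket_prolongation hZa (hXa hj)]
    exact hinv₁ hj c _ ((hZa.lieBracket_vectorField (m := ∞) (hXa hj) (by simp)).differentiableAt
      (by simp)) hc
  let Y : ReducedSpace m k → ReducedSpace m k := fun r => C (κ r)
  have hY : ContDiffOn ℝ ∞ Y W := fun r hr => (hC (hκO hr)).comp_contDiffWithinAt r (hκ r hr)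
  refine ⟨Y, ⟨hY, hCinv, fun b => ((fderiv ℝ φ (σ b) (X (σ b))).1,
    (fderiv ℝ φ (σ b) (X (σ b))).2.2), fun r hr => ?_⟩, fun r hr => ?_⟩
  · have h1 := base_fderiv_jetMap (hφa (hOφ _ (hκO hr))) (hOτ _ (hκO hr)) (prolongation X (κ r))
    have h2 : (prolongation X (κ r)).base = X (κ r).base := rfl
    beta_reduce
    rw [← hκσ r hr, ← h2, ← h1]
    simp only [Y, C, hRfd (hκO hr)]
    rfl
  · have hj := hκO hr
    have hrd := hW.mem_nhds hr
    have hYd : DifferentiableAt ℝ Y r := (hY.contDiffAt hrd).differentiableAt (by simp)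
    have hf'd := hf'.contDiffAt hrd
    have hÂ : DifferentiableAt ℝ (reducedSystemField f') r :=
      (contDiffAt_const.prodMk (contDiffAt_snd.snd.snd.prodMk
        (hf'd.fst.prodMk hf'd.snd))).differentiableAt (n := ∞) (by simp)
    obtain ⟨μ, hμ⟩ := hsym hXs hj
    have h1 := lieBracket_of_related (hR hj) ((hXa hj).prolongation.differentiableAt (by simp))
      ((hA' hj).differentiableAt (by simp)) (Y := Y) (Y' := reducedSystemField f')
      (by rwa [hRκ r hr]) (by rwa [hRκ r hr])
      (Filter.eventually_of_mem (hO.mem_nhds hj) hCinv)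
      (Filter.eventually_of_mem (hO.mem_nhds hj) hBf')
    have h2 : fderiv ℝ (reducedCoords φ) (κ r) (A' (κ r)) = reducedSystemField f' r := by
      rw [← hRκ r hr, hRκ r hr, ← hRκ r hr]
      simpa only [hRκ r hr] using hBf' _ hj
    rw [hμ, map_smul, h2, hRκ r hr] at h1
    -- The reduced operator has `t`-component 1, so comparing `t`-components in `[Y, Â] = μ Â` gives
    -- `μ = -Â(ξ̂)`.
    have h3 : (VectorField.lieBracket ℝ Y (reducedSystemField f') r).1 =
        -fderiv ℝ (fun q => (Y q).1) r (reducedSystemField f' r) := by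
      have h4 := hÂ.hasFDerivAt.fst.fderiv
      have h5 : fderiv ℝ (fun r => (reducedSystemField f' r).1) r = 0 := fderiv_const_apply 1
      have h6 : (fderiv ℝ (reducedSystemField f') r (Y r)).1 = 0 := by
        rw [h5] at h4
        exact (congrArg (fun A : _ →L[ℝ] ℝ => A (Y r)) h4).symm
      rw [VectorField.lieBracket, Prod.fst_sub, h6, zero_sub, hYd.hasFDerivAt.fst.fderiv]
      rfl
    rw [← h1] at h3 ⊢
    rw [← h3]
    congr 1
    exact (mul_one μ).symm

end Reduction

/-! ### The last derived algebra of a solvable Lie algebra of vector fields -/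

section Solvable

lemma IsSolvableOfLevel.isLieAbelian {L : Type*} [LieRing L] [LieAlgebra ℝ L] {n : ℕ}
    (h : IsSolvableOfLevel L n) (hn : 1 ≤ n) :
    IsLieAbelian (LieAlgebra.derivedSeries ℝ L (n - 1)) := by
  obtain ⟨n, rfl⟩ := Nat.exists_eq_add_of_le' hn
  have h1 : ⁅LieAlgebra.derivedSeries ℝ L n, LieAlgebra.derivedSeries ℝ L n⁆ = ⊥ := by
    have h2 := h.1
    rwa [LieAlgebra.derivedSeries_def, LieAlgebra.derivedSeriesOfIdeal_succ] at h2
  exact LieSubmodule.lie_abelian_iff_lie_self_eq_bot _ |>.2 h1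

variable {E : Type*} [NormedAddCommGroup E] [NormedSpace ℝ E] {Ω : TopologicalSpace.Opens E}

/-- The value at a point of a smooth vector field of a Lie algebra, as a linear map. -/
def evalAt (g : LieSubalgebra ℝ (smoothVectorFields Ω)) (I : LieIdeal ℝ g) (p : E) : I →ₗ[ℝ] E where
  toFun Z := Z.1.1.1 p
  map_add' _ _ := rfl
  map_smul' _ _ := rfl

lemma sum_evalAt {g : LieSubalgebra ℝ (smoothVectorFields Ω)} {I : LieIdeal ℝ g} {m : ℕ}
    (b : Module.Basis (Fin m) ℝ I) (Z : I) (p : E) :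
    Z.1.1.1 p = ∑ i, b.repr Z i • (b i).1.1.1 p := by
  have h := congrArg (evalAt g I p) (b.sum_repr Z)
  rw [map_sum] at h
  simp only [map_smul] at h
  exact h.symm

end Solvable

theorem theorem3 (N : ℕ)
    (Ω : TopologicalSpace.Opens (BaseSpace (Fin N → ℝ)))
    (U : TopologicalSpace.Opens (JetSpace (Fin N → ℝ)))
    (hUΩ : ∀ j ∈ U, j.base ∈ Ω)
    (f : JetSpace (Fin N → ℝ) → (Fin N → ℝ))
    (hf : ContDiffOn ℝ ∞ f U)
    (g : LieSubalgebra ℝ (smoothVectorFields Ω)) [FiniteDimensional ℝ g]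
    (hsymm : ∀ Z ∈ g, IsPointSymmetry f U Z.1)
    (n : ℕ) (hn : 1 ≤ n) (hsolv : IsSolvableOfLevel g n)
    (htrans : ∀ p ∈ Ω, ∀ Z ∈ LieAlgebra.derivedSeries ℝ g (n - 1), Z.1.1 p = 0 → Z = 0) :
    IsLieAbelian (LieAlgebra.derivedSeries ℝ g (n - 1)) ∧
    ∀ (m : ℕ) (b : Module.Basis (Fin m) ℝ (LieAlgebra.derivedSeries ℝ g (n - 1))),
      -- the first integration method can be applied to the generators `b i`
      (∀ j : JetSpace (Fin N → ℝ), j.base ∈ Ω →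
        (∀ Z ∈ LieAlgebra.derivedSeries ℝ g (n - 1), Z.1.1 j.base ≠ (1, j.2.2)) →
        ∃ (k : ℕ) (φ : OpenPartialHomeomorph (BaseSpace (Fin N → ℝ)) (BaseSpace (SplitSpace m k))),
          IsNormalFormChart Ω (fun i => (b i).1.1.1) φ ∧ j.base ∈ φ.source ∧
          totalDeriv (fun p => (φ p).1) j ≠ 0) ∧
      -- in whatever way it is applied, the generators of the coset are inherited
      (∀ (k : ℕ) (φ : OpenPartialHomeomorph (BaseSpace (Fin N → ℝ)) (BaseSpace (SplitSpace m k))),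
        IsNormalFormChart Ω (fun i => (b i).1.1.1) φ →
        ∀ j ∈ U, j.base ∈ φ.source → totalDeriv (fun p => (φ p).1) j ≠ 0 →
        ∃ (O : Set (JetSpace (Fin N → ℝ))) (W : Set (ReducedSpace m k))
          (f' : ReducedSpace m k → SplitSpace m k),
          j ∈ O ∧ IsReduction f U φ O W f' ∧
          ∀ Z ∈ derivedCoset g 0 (n - 1), ∃ Y : ReducedSpace m k → ReducedSpace m k,
            IsReducedGenerator Z.1.1 φ O W Y ∧
            SatisfiesSymmetryCondition (reducedSystemField f') Y W) := by
  have habel := hsolv.isLieAbelian hn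
  refine ⟨habel, fun m b => ⟨fun j hj hspan => ?_, fun k φ hφ j hj hjφ hτ => ?_⟩⟩
  · refine exists_isNormalFormChart Ω.isOpen (fun i => (b i).1.1.2.1) (fun p hp i i' => ?_) hj ?_ ?_
    · have h1 : ⁅b i, b i'⁆ = 0 := trivial_lie_zero _ _ _ _
      have h2 : (⁅(b i).1.1, (b i').1.1⁆ : smoothVectorFields Ω).1 p = 0 :=
        congrArg (fun Z : LieAlgebra.derivedSeries ℝ g (n - 1) => Z.1.1.1 p) h1
      rwa [smoothVectorFields.bracket_apply _ _ hp] at h2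
    -- Transitivity says that evaluation at the point has zero kernel on the ideal.
    · refine b.linearIndependent.map' (evalAt g _ j.base) (LinearMap.ker_eq_bot'.2 fun Z hZ => ?_)
      exact Subtype.ext (htrans _ hj Z.1 Z.2 hZ)
    · intro h
      obtain ⟨c, hc⟩ := Submodule.mem_span_range_iff_exists_fun ℝ |>.1 h
      refine hspan (∑ i, c i • b i : LieAlgebra.derivedSeries ℝ g (n - 1)).1 (Subtype.property _) ?_
      have h1 : evalAt g _ j.base (∑ i, c i • b i) = ∑ i, c i • (b i).1.1.1 j.base := by
        rw [map_sum]
        simp only [map_smul]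
        rfl
      exact h1.trans hc
  · obtain ⟨O, W, f', hjO, hred, hinh⟩ := exists_isReduction Ω.isOpen U.isOpen hf
      (fun i => (b i).1.1.2.1) (fun i => hsymm _ (b i).1.2) hφ hj hjφ hτ
    refine ⟨O, W, f', hjO, hred, fun Z _ => hinh _ Z.1.2.1 (hsymm _ Z.2) fun i => ?_⟩
    -- The bracket stays in the ideal, so its coordinates in the basis `b` are constants, and the
    -- chart turns it into a constant field along the `sⁱ`.
    let X : LieAlgebra.derivedSeries ℝ g (n - 1) :=
      ⟨⁅(b i).1, Z⁆, lie_mem_left ℝ g _ _ _ (b i).2⟩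
    refine ⟨fun l => b.repr X l, fun p hp => ?_⟩
    have h1 : VectorField.lieBracket ℝ (b i).1.1.1 Z.1.1 p = X.1.1.1 p :=
      (smoothVectorFields.bracket_apply (b i).1.1 Z.1 (hφ.source_subset hp)).symm
    rw [h1, sum_evalAt b X p, map_sum]
    simp only [map_smul, hφ.normal_form p hp]
    refine Prod.ext (by simp [Prod.fst_sum]) (Prod.ext ?_ (by simp [Prod.snd_sum]))
    ext l
    simp [Prod.fst_sum, Prod.snd_sum, Finset.sum_apply, Pi.single_apply]
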